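/- Let $k$ be a commutative ring. Algebras are unital associative $k$-algebras, bimodules are $k$-symmetric, and an $A$-coring is a comonoid $(\mathfrak C,\Delta_{\mathfrak C},\varepsilon_{\mathfrak C})$ in the category of $A$-bimodules; we write $(\mathfrak C:A)$. Let $\mathsf{Bim}$ be the bicategory of algebras, bimodules (a 1-cell $A\to B$ is a $(B,A)$-bimodule) and bilinear maps, with composition of 1-cells given by $\otimes$. The bicategory $\mathsf{REM}(\mathsf{Bim})$ has corings as objects. A 1-cell $(\mathfrak C:A)\to(\mathfrak D:B)$ is a pair $(\Sigma,\mathfrak s)$ of a $(B,A)$-bimodule $\Sigma$ and a bilinear map $\mathfrak s:\mathfrak D\otimes_B\Sigma\to\Sigma\otimes_A\mathfrak C$ with $(\Sigma\otimes\varepsilon_{\mathfrak C})\mathfrak s=\varepsilon_{\mathfrak D}\otimes\Sigma$ (up to the unit isomorphisms) and $(\Sigma\otimes\Delta_{\mathfrak C})\mathfrak s=(\mathfrak s\otimes\mathfrak C)(\mathfrak D\otimes\mathfrak s)(\Delta_{\mathfrak D}\otimes\Sigma)$. A 2-cell $(\Sigma,\mathfrak s)\to(\widetilde\Sigma,\widetilde{\mathfrak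 s})$ is a bilinear map $\mathfrak a:\mathfrak D\otimes_B\Sigma\to\widetilde\Sigma$ with $(\mathfrak a\otimes\mathfrak C)(\mathfrak D\otimes\mathfrak s)(\Delta_{\mathfrak D}\otimes\Sigma)=\widetilde{\mathfrak s}(\mathfrak D\otimes\mathfrak a)(\Delta_{\mathfrak D}\otimes\Sigma)$. The identity 2-cell is $\varepsilon_{\mathfrak D}\otimes\Sigma$; vertical composition is $\mathfrak b\bullet\mathfrak a=\mathfrak b(\mathfrak D\otimes\mathfrak a)(\Delta_{\mathfrak D}\otimes\Sigma)$; the composite of $(\Sigma,\mathfrak s)$ with a 1-cell $(W,\mathfrak w)$ into $(\mathfrak C:A)$ is $(\Sigma\otimes_AW,(\Sigma\otimes\mathfrak w)(\mathfrak s\otimes W))$; the horizontal composite of $\mathfrak a:\mathfrak D\otimes_B\Sigma\to\widetilde\Sigma$ and $\mathfrak b:\mathfrak C\otimes_AW\to\widetilde W$ is $(\widetilde\Sigma\otimes\mathfrak b)(\widetilde{\mathfrak s}\otimes W)(\mathfrak D\otimes\mathfrak a\otimes W)(\Delta_{\mathfrak D}\otimes\Sigma\otimes W)$; the identity 1-cell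 is $(A,\mathfrak C)$. The bicategory $\mathsf{LEM}(\mathsf{Bim})$ is the left-right mirror image: its objects are corings, a 1-cell $(\mathfrak C:A)\to(\mathfrak D:B)$ is a pair $(\Xi,\mathfrak x)$ of an $(A,B)$-bimodule and a bilinear map $\mathfrak x:\Xi\otimes_B\mathfrak D\to\mathfrak C\otimes_A\Xi$ compatible with counits and comultiplications, and a 2-cell is a bilinear map $\Xi\otimes_B\mathfrak D\to\widetilde\Xi$ satisfying the mirrored identity. Let $\mathsf{fREM}(\mathsf{Bim})$ (resp. $\mathsf{fLEM}(\mathsf{Bim})$) be the sub-bicategory with the same objects, with those 1-cells for which $\Sigma_A$ (resp. ${}_A\Xi$) is finitely generated and projective, and with all 2-cells between them. For a 1-cell $(\Sigma,\mathfrak s):(\mathfrak C:A)\to(\mathfrak D:B)$ of $\mathsf{fREM}(\mathsf{Bim})$ let $\Sigma^*=\mathrm{Hom}_A(\Sigma_A,A_A)$, an $(A,B)$-bimodule, let $\{e_i,e_i^*\}$ be a finite dual basis of $\Sigma_A$, and put $$\mathfrak s_*:\Sigma^*\otimes_B\mathfrak D\to\mathfrak C\otimes_A\Sigma^*,\quad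 s^*\otimes d\mapsto\sum_i\big((s^*\otimes_A\mathfrak C)\circ\mathfrak s(d\otimes e_i)\big)\otimes e_i^*,$$ and for a 2-cell $\mathfrak a:(\Sigma,\mathfrak s)\to(\widetilde\Sigma,\widetilde{\mathfrak s})$ put $$\mathfrak a_*:\widetilde\Sigma^*\otimes_B\mathfrak D\to\Sigma^*,\quad \widetilde s^*\otimes d\mapsto\sum_i\widetilde s^*(\mathfrak a(d\otimes e_i))\,e_i^*.$$ Then the following hold. 1. The maps $\mathfrak s_*$ and $\mathfrak a_*$ do not depend on the dual basis, $(\Sigma^*,\mathfrak s_*)$ is a 1-cell $(\mathfrak C:A)\to(\mathfrak D:B)$ of $\mathsf{fLEM}(\mathsf{Bim})$, $\mathfrak a_*$ is a 2-cell $(\widetilde\Sigma^*,\widetilde{\mathfrak s}_*)\to(\Sigma^*,\mathfrak s_*)$, and $(\Sigma,\mathfrak s)\mapsto(\Sigma^*,\mathfrak s_*)$, $\mathfrak a\mapsto\mathfrak a_*$ is a contravariant functor $\mathscr D$ from the hom-category $\mathsf{fREM}(\mathsf{Bim})((\mathfrak C:A),(\mathfrak D:B))$ to the hom-category $\mathsf{fLEM}(\mathsf{Bim})((\mathfrak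 C:A),(\mathfrak D:B))$. 2. For all corings $(\mathfrak C:A)$ and $(\mathfrak D:B)$ this contravariant functor is a duality, i.e. it is an equivalence from the first hom-category to the opposite of the second. 3. Let $\mathsf{fLEM}(\mathsf{Bim})^{co}$ be $\mathsf{fLEM}(\mathsf{Bim})$ with its 2-cells reversed. There is a pseudofunctor $\mathsf{fREM}(\mathsf{Bim})\to\mathsf{fLEM}(\mathsf{Bim})^{co}$ that is the identity on objects and is given by the functors $\mathscr D$ on hom-categories, and it is a biequivalence: it is an equivalence on every hom-category, and every object of the target is equivalent, in the target, to an object in its image. -/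

import Mathlib

open CategoryTheory Bicategory MulOpposite
universe w u v

/-- The objects of the bicategory `REM(B) = EM(B^coop)^coop`: comonads in `B`. In the bicategory of
bimodules these are the corings `(C : A)`, with `base = A` and `cell = C`. -/
structure REM (B : Type u) [Bicategory.{w, v} B] where
  base : B
  cell : base ⟶ base
  [comonad : Comonad cell]

attribute [instance] REM.comonad

namespace REM
variable {B : Type u} [Bicategory.{w, v} B] (X : REM B)
/-- The comultiplication. -/
abbrev comul : X.cell ⟶ X.cell ≫ X.cell := Comonad.comul
/-- The counit. -/
abbrev counit : X.cell ⟶ 𝟙 X.base := Comonad.counit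

theorem coassoc {a : B} (f : a ⟶ X.base) :
    f ◁ X.comul ⊗≫ f ◁ X.comul ▷ X.cell ⊗≫ 𝟙 (f ≫ X.cell ≫ X.cell ≫ X.cell) =
    f ◁ X.comul ⊗≫ f ◁ X.cell ◁ X.comul ⊗≫ 𝟙 (f ≫ X.cell ≫ X.cell ≫ X.cell) := by
  have := Comonad.comul_assoc X.cell
  calc _ = f ◁ (X.comul ≫ X.comul ▷ X.cell ≫ (α_ _ _ _).hom) := by bicategory
   _ = _ := by rw [← this]; bicategory

theorem counit_left {a : B} (f : a ⟶ X.base) :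
    f ◁ X.comul ⊗≫ f ◁ X.counit ▷ X.cell ⊗≫ 𝟙 (f ≫ X.cell) = 𝟙 (f ≫ X.cell) := by
  have := Comonad.counit_comul X.cell
  calc _ = f ◁ (X.comul ≫ X.counit ▷ X.cell) ⊗≫ 𝟙 _ := by bicategory
   _ = _ := by rw [this]; bicategory

theorem counit_right {a : B} (f : a ⟶ X.base) :
    f ◁ X.comul ⊗≫ f ◁ X.cell ◁ X.counit ⊗≫ 𝟙 (f ≫ X.cell) = 𝟙 (f ≫ X.cell) := by
  have := Comonad.comul_counit X.cell
  calc _ = f ◁ (X.comul ≫ X.cell ◁ X.counit) ⊗≫ 𝟙 _ := by bicategory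
   _ = _ := by rw [this]; bicategory

theorem counit_strict {a : B} (f : a ⟶ X.base) {g : a ⟶ X.base} (u : f ⟶ g) :
    f ◁ X.comul ≫ (α_ f X.cell X.cell).inv ≫ (f ◁ X.counit ≫ (ρ_ f).hom ≫ u) ▷ X.cell =
      u ▷ X.cell := by
  calc _ = (f ◁ X.comul ⊗≫ f ◁ X.counit ▷ X.cell ⊗≫ 𝟙 (f ≫ X.cell)) ≫ u ▷ X.cell := by
        bicategory
    _ = _ := by rw [X.counit_left]; bicategory

end REM

namespace REM
variable {B : Type u} [Bicategory.{w, v} B]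

/-- The two axioms of a 1-cell `(f, s)` from `X` to `Y`: for `X = (C : A)` and `Y = (D : B)` in the
bicategory of bimodules, `f ≫ Y.cell` is `D ⊗_B Σ` and `X.cell ≫ f` is `Σ ⊗_A C`, and the axioms
say that `s : D ⊗_B Σ ⟶ Σ ⊗_A C` is compatible with counits and comultiplications. -/
structure IsCell (X Y : REM B) (f : X.base ⟶ Y.base) (s : f ≫ Y.cell ⟶ X.cell ≫ f) :
    Prop where
  counit : s ≫ X.counit ▷ f ≫ (λ_ f).hom = f ◁ Y.counit ≫ (ρ_ f).hom
  comul : s ≫ X.comul ▷ f =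
    f ◁ Y.comul ≫ (α_ f Y.cell Y.cell).inv ≫ s ▷ Y.cell ≫
      (α_ X.cell f Y.cell).hom ≫ X.cell ◁ s ≫ (α_ X.cell X.cell f).inv

/-- 1-cells. -/
structure Cell (X Y : REM B) where
  f : X.base ⟶ Y.base
  s : f ≫ Y.cell ⟶ X.cell ≫ f
  isCell : IsCell X Y f s

/-- The axiom of a 2-cell `a : D ⊗_B Σ ⟶ Σ'` from `(Σ, s)` to `(Σ', s')`:
`(a ⊗ C) ∘ (D ⊗ s) ∘ (Δ ⊗ Σ) = s' ∘ (D ⊗ a) ∘ (Δ ⊗ Σ)`. -/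
def IsCell₂ {X Y : REM B} (S T : Cell X Y) (a : S.f ≫ Y.cell ⟶ T.f) : Prop :=
  S.f ◁ Y.comul ≫ (α_ S.f Y.cell Y.cell).inv ≫ S.s ▷ Y.cell ≫
      (α_ X.cell S.f Y.cell).hom ≫ X.cell ◁ a =
    S.f ◁ Y.comul ≫ (α_ S.f Y.cell Y.cell).inv ≫ a ▷ Y.cell ≫ T.s

/-- 2-cells. -/
@[ext]
structure Cell₂ {X Y : REM B} (S T : Cell X Y) where
  hom : S.f ≫ Y.cell ⟶ T.f
  isCell₂ : IsCell₂ S T hom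

theorem Cell₂.comm {X Y : REM B} {S T : Cell X Y} (a : Cell₂ S T) :
    S.f ◁ Y.comul ≫ (α_ S.f Y.cell Y.cell).inv ≫ S.s ▷ Y.cell ≫
        (α_ X.cell S.f Y.cell).hom ≫ X.cell ◁ a.hom =
      S.f ◁ Y.comul ≫ (α_ S.f Y.cell Y.cell).inv ≫ a.hom ▷ Y.cell ≫ T.s :=
  a.isCell₂

/-- A 2-cell `u : Σ ⟶ Σ'` of `B` commuting with the structure maps gives the 2-cell `ε ⊗ u`. -/
@[simps]
def Cell₂.ofStrict {X Y : REM B} {S T : Cell X Y} (u : S.f ⟶ T.f)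
    (h : S.s ≫ X.cell ◁ u = u ▷ Y.cell ≫ T.s) : Cell₂ S T where
  hom := S.f ◁ Y.counit ≫ (ρ_ S.f).hom ≫ u
  isCell₂ := by
    unfold IsCell₂
    calc _ = S.f ◁ Y.comul ⊗≫ (S.s ▷ Y.cell ≫ (X.cell ≫ S.f) ◁ Y.counit) ⊗≫ X.cell ◁ u := by bicategory
      _ = (S.f ◁ Y.comul ⊗≫ S.f ◁ Y.cell ◁ Y.counit ⊗≫ 𝟙 (S.f ≫ Y.cell)) ⊗≫ (S.s ≫ X.cell ◁ u) := by
        rw [← whisker_exchange]; bicategory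
      _ = (S.f ◁ Y.comul ⊗≫ S.f ◁ Y.counit ▷ Y.cell ⊗≫ 𝟙 (S.f ≫ Y.cell)) ⊗≫ (u ▷ Y.cell ≫ T.s) := by
        rw [Y.counit_right, Y.counit_left, h]
      _ = _ := by bicategory

/-- The identity 2-cell `ε ⊗ Σ`. -/
def id₂ {X Y : REM B} (S : Cell X Y) : Cell₂ S S :=
  Cell₂.ofStrict (𝟙 S.f) (by simp)

/-- Vertical composition `b ∘ (D ⊗ a) ∘ (Δ ⊗ Σ)`. -/
@[simps]
def comp₂ {X Y : REM B} {S T U : Cell X Y} (a : Cell₂ S T) (b : Cell₂ T U) : Cell₂ S U where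
  hom := S.f ◁ Y.comul ≫ (α_ S.f Y.cell Y.cell).inv ≫ a.hom ▷ Y.cell ≫ b.hom
  isCell₂ := by
    unfold IsCell₂
    have ha := a.comm
    have hb := b.comm
    calc _ = S.f ◁ Y.comul ⊗≫ (S.s ▷ Y.cell ≫ (X.cell ≫ S.f) ◁ Y.comul) ⊗≫
            X.cell ◁ a.hom ▷ Y.cell ≫ X.cell ◁ b.hom := by bicategory
      _ = (S.f ◁ Y.comul ⊗≫ S.f ◁ Y.cell ◁ Y.comul ⊗≫ 𝟙 (S.f ≫ Y.cell ≫ Y.cell ≫ Y.cell)) ⊗≫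
            S.s ▷ Y.cell ▷ Y.cell ⊗≫ X.cell ◁ a.hom ▷ Y.cell ≫ X.cell ◁ b.hom := by
        rw [← whisker_exchange]; bicategory
      _ = S.f ◁ Y.comul ⊗≫ (S.f ◁ Y.comul ≫ (α_ S.f Y.cell Y.cell).inv ≫ S.s ▷ Y.cell ≫
            (α_ X.cell S.f Y.cell).hom ≫ X.cell ◁ a.hom) ▷ Y.cell ⊗≫ X.cell ◁ b.hom := by
        rw [← Y.coassoc]; bicategory
      _ = (S.f ◁ Y.comul ⊗≫ S.f ◁ Y.comul ▷ Y.cell ⊗≫ 𝟙 (S.f ≫ Y.cell ≫ Y.cell ≫ Y.cell)) ⊗≫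
            a.hom ▷ Y.cell ▷ Y.cell ⊗≫ T.s ▷ Y.cell ⊗≫ X.cell ◁ b.hom := by
        rw [ha]; bicategory
      _ = S.f ◁ Y.comul ⊗≫ ((S.f ≫ Y.cell) ◁ Y.comul ≫ a.hom ▷ (Y.cell ≫ Y.cell)) ⊗≫
            T.s ▷ Y.cell ⊗≫ X.cell ◁ b.hom := by
        rw [Y.coassoc]; bicategory
      _ = S.f ◁ Y.comul ⊗≫ a.hom ▷ Y.cell ⊗≫ (T.f ◁ Y.comul ≫ (α_ T.f Y.cell Y.cell).inv ≫
            T.s ▷ Y.cell ≫ (α_ X.cell T.f Y.cell).hom ≫ X.cell ◁ b.hom) := by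
        rw [whisker_exchange]; bicategory
      _ = S.f ◁ Y.comul ⊗≫ (a.hom ▷ Y.cell ≫ T.f ◁ Y.comul) ⊗≫ b.hom ▷ Y.cell ≫ U.s := by
        rw [hb]; bicategory
      _ = (S.f ◁ Y.comul ⊗≫ S.f ◁ Y.cell ◁ Y.comul ⊗≫ 𝟙 (S.f ≫ Y.cell ≫ Y.cell ≫ Y.cell)) ⊗≫
            a.hom ▷ Y.cell ▷ Y.cell ⊗≫ b.hom ▷ Y.cell ≫ U.s := by
        rw [← whisker_exchange]; bicategory
      _ = _ := by rw [← Y.coassoc]; bicategory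

theorem comp₂_ofStrict {X Y : REM B} {S T U : Cell X Y} (a : Cell₂ S T) (u : T.f ⟶ U.f)
    (h : T.s ≫ X.cell ◁ u = u ▷ Y.cell ≫ U.s) :
    (comp₂ a (Cell₂.ofStrict u h)).hom = a.hom ≫ u := by
  calc _ = S.f ◁ Y.comul ⊗≫ (a.hom ▷ Y.cell ≫ T.f ◁ Y.counit) ⊗≫ u := by simp; bicategory
    _ = (S.f ◁ Y.comul ⊗≫ S.f ◁ Y.cell ◁ Y.counit ⊗≫ 𝟙 (S.f ≫ Y.cell)) ⊗≫ a.hom ≫ u := by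
      rw [← whisker_exchange]; bicategory
    _ = _ := by rw [Y.counit_right]; bicategory

theorem ofStrict_comp₂ {X Y : REM B} {S T U : Cell X Y} (u : S.f ⟶ T.f)
    (h : S.s ≫ X.cell ◁ u = u ▷ Y.cell ≫ T.s) (a : Cell₂ T U) :
    (comp₂ (Cell₂.ofStrict u h) a).hom = u ▷ Y.cell ≫ a.hom := by
  calc _ = (S.f ◁ Y.comul ⊗≫ S.f ◁ Y.counit ▷ Y.cell ⊗≫ 𝟙 (S.f ≫ Y.cell)) ⊗≫ u ▷ Y.cell ≫ a.hom := by
        simp; bicategory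
    _ = _ := by rw [Y.counit_left]; bicategory

/-- Composition of 1-cells: `(Σ ⊗ W, (Σ ⊗ w) ∘ (s ⊗ W))`. -/
def comp₁ {X Y Z : REM B} (W : Cell X Y) (S : Cell Y Z) : Cell X Z where
  f := W.f ≫ S.f
  s := (α_ W.f S.f Z.cell).hom ≫ W.f ◁ S.s ≫ (α_ W.f Y.cell S.f).inv ≫ W.s ▷ S.f ≫
    (α_ X.cell W.f S.f).hom
  isCell :=
  { counit := by
      have hW := W.isCell.counit
      have hS := S.isCell.counit
      calc _ = 𝟙 _ ⊗≫ W.f ◁ S.s ⊗≫ (W.s ≫ X.counit ▷ W.f ≫ (λ_ W.f).hom) ▷ S.f := by bicategory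
        _ = 𝟙 _ ⊗≫ W.f ◁ (S.s ≫ Y.counit ▷ S.f ≫ (λ_ S.f).hom) := by rw [hW]; bicategory
        _ = _ := by rw [hS]; bicategory
    comul := by
      have hW := W.isCell.comul
      have hS := S.isCell.comul
      calc _ = 𝟙 _ ⊗≫ W.f ◁ S.s ⊗≫ (W.s ≫ X.comul ▷ W.f) ▷ S.f ⊗≫ 𝟙 _ := by bicategory
        _ = 𝟙 _ ⊗≫ W.f ◁ (S.s ≫ Y.comul ▷ S.f) ⊗≫ W.s ▷ Y.cell ▷ S.f ⊗≫ X.cell ◁ W.s ▷ S.f ⊗≫ 𝟙 _ := by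
          rw [hW]; bicategory
        _ = 𝟙 _ ⊗≫ W.f ◁ S.f ◁ Z.comul ⊗≫ W.f ◁ S.s ▷ Z.cell ⊗≫
            ((W.f ≫ Y.cell) ◁ S.s ≫ W.s ▷ (Y.cell ≫ S.f)) ⊗≫ X.cell ◁ W.s ▷ S.f ⊗≫ 𝟙 _ := by
          rw [hS]; bicategory
        _ = _ := by rw [whisker_exchange]; bicategory }

/-- The identity 1-cell `(A, C)`. -/
def id₁ (X : REM B) : Cell X X where
  f := 𝟙 X.base
  s := (λ_ X.cell).hom ≫ (ρ_ X.cell).inv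
  isCell := ⟨by bicategory, by bicategory⟩

instance : CategoryStruct (REM B) where
  Hom := Cell
  id := id₁
  comp := comp₁

instance homCategory (X Y : REM B) : Category (X ⟶ Y) where
  Hom S T := Cell₂ S T
  id := id₂
  comp := comp₂
  id_comp a := by
    ext; exact (ofStrict_comp₂ _ _ a).trans (by simp)
  comp_id a := by
    ext; exact (comp₂_ofStrict a _ _).trans (by simp)
  assoc {S T U V} a b c := by
    ext
    change S.f ◁ Y.comul ≫ (α_ S.f Y.cell Y.cell).inv ≫
        (S.f ◁ Y.comul ≫ (α_ S.f Y.cell Y.cell).inv ≫ a.hom ▷ Y.cell ≫ b.hom) ▷ Y.cell ≫ c.hom =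
      S.f ◁ Y.comul ≫ (α_ S.f Y.cell Y.cell).inv ≫ a.hom ▷ Y.cell ≫
        T.f ◁ Y.comul ≫ (α_ T.f Y.cell Y.cell).inv ≫ b.hom ▷ Y.cell ≫ c.hom
    calc _ = (S.f ◁ Y.comul ⊗≫ S.f ◁ Y.comul ▷ Y.cell ⊗≫ 𝟙 (S.f ≫ Y.cell ≫ Y.cell ≫ Y.cell)) ⊗≫
            a.hom ▷ Y.cell ▷ Y.cell ⊗≫ b.hom ▷ Y.cell ≫ c.hom := by bicategory
      _ = S.f ◁ Y.comul ⊗≫ ((S.f ≫ Y.cell) ◁ Y.comul ≫ a.hom ▷ (Y.cell ≫ Y.cell)) ⊗≫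
            b.hom ▷ Y.cell ≫ c.hom := by
        rw [Y.coassoc]; bicategory
      _ = _ := by rw [whisker_exchange]; bicategory

@[simp] theorem comp_f {X Y Z : REM B} (W : X ⟶ Y) (S : Y ⟶ Z) :
    (W ≫ S).f = W.f ≫ S.f := rfl
@[simp] theorem comp_s {X Y Z : REM B} (W : X ⟶ Y) (S : Y ⟶ Z) :
    (W ≫ S).s = (α_ W.f S.f Z.cell).hom ≫ W.f ◁ S.s ≫ (α_ W.f Y.cell S.f).inv ≫ W.s ▷ S.f ≫
    (α_ X.cell W.f S.f).hom := rfl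
@[simp] theorem id_f (X : REM B) : Cell.f (𝟙 X) = 𝟙 X.base := rfl
@[simp] theorem id_s (X : REM B) : Cell.s (𝟙 X) = (λ_ X.cell).hom ≫ (ρ_ X.cell).inv := rfl
@[simp] theorem comp_hom {X Y : REM B} {S T U : X ⟶ Y} (a : S ⟶ T) (b : T ⟶ U) :
    (a ≫ b).hom = S.f ◁ Y.comul ≫ (α_ S.f Y.cell Y.cell).inv ≫ a.hom ▷ Y.cell ≫ b.hom := rfl
@[simp] theorem id_hom {X Y : REM B} (S : X ⟶ Y) :
    Cell₂.hom (𝟙 S) = S.f ◁ Y.counit ≫ (ρ_ S.f).hom :=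
  congrArg (S.f ◁ Y.counit ≫ ·) (Category.comp_id _)

@[ext] theorem hom_ext {X Y : REM B} {S T : X ⟶ Y} {a b : S ⟶ T} (h : a.hom = b.hom) :
    a = b := Cell₂.ext h

/-- A 2-cell of `B` commuting with the structure maps, as a 2-cell. -/
def strict {X Y : REM B} {S T : X ⟶ Y} (u : S.f ⟶ T.f)
    (h : S.s ≫ X.cell ◁ u = u ▷ Y.cell ≫ T.s) : S ⟶ T := Cell₂.ofStrict u h

theorem strict_hom {X Y : REM B} {S T : X ⟶ Y} (u : S.f ⟶ T.f)
    (h : S.s ≫ X.cell ◁ u = u ▷ Y.cell ≫ T.s) :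
    (strict u h).hom = S.f ◁ Y.counit ≫ (ρ_ S.f).hom ≫ u := rfl

theorem comp_strict {X Y : REM B} {S T U : X ⟶ Y} (a : S ⟶ T) (u : T.f ⟶ U.f)
    (h : T.s ≫ X.cell ◁ u = u ▷ Y.cell ≫ U.s) :
    (a ≫ strict u h).hom = a.hom ≫ u := comp₂_ofStrict a u h

theorem strict_comp {X Y : REM B} {S T U : X ⟶ Y} (u : S.f ⟶ T.f)
    (h : S.s ≫ X.cell ◁ u = u ▷ Y.cell ≫ T.s) (a : T ⟶ U) :
    (strict u h ≫ a).hom = u ▷ Y.cell ≫ a.hom := ofStrict_comp₂ u h a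

/-- An invertible 2-cell of `B` commuting with the structure maps, as an isomorphism. -/
@[simps]
def isoStrict {X Y : REM B} {S T : X ⟶ Y} (u : S.f ≅ T.f)
    (h : S.s ≫ X.cell ◁ u.hom = u.hom ▷ Y.cell ≫ T.s) : S ≅ T where
  hom := strict u.hom h
  inv := strict u.inv (by
    rw [← cancel_epi (u.hom ▷ Y.cell), ← reassoc_of% h]; simp)
  hom_inv_id := by ext; rw [strict_comp, strict_hom, id_hom]; rw [← whisker_exchange_assoc]; simp
  inv_hom_id := by ext; rw [strict_comp, strict_hom, id_hom]; rw [← whisker_exchange_assoc]; simp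

/-- The horizontal composite `b ⊗ W` of a 2-cell `b` and the identity of `W`. -/
def whiskerL {X Y Z : REM B} (W : X ⟶ Y) {S T : Y ⟶ Z} (b : S ⟶ T) : W ≫ S ⟶ W ≫ T where
  hom := (α_ W.f S.f Z.cell).hom ≫ W.f ◁ b.hom
  isCell₂ := by
    unfold IsCell₂
    have hb := b.comm
    simp only [comp_f, comp_s]
    calc _ = 𝟙 _ ⊗≫ W.f ◁ S.f ◁ Z.comul ⊗≫ W.f ◁ S.s ▷ Z.cell ⊗≫
          (W.s ▷ (S.f ≫ Z.cell) ≫ (X.cell ≫ W.f) ◁ b.hom) ⊗≫ 𝟙 _ := by bicategory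
      _ = 𝟙 _ ⊗≫ W.f ◁ (S.f ◁ Z.comul ≫ (α_ S.f Z.cell Z.cell).inv ≫ S.s ▷ Z.cell ≫
            (α_ Y.cell S.f Z.cell).hom ≫ Y.cell ◁ b.hom) ⊗≫ W.s ▷ T.f ⊗≫ 𝟙 _ := by
        rw [← whisker_exchange]; bicategory
      _ = _ := by rw [hb]; bicategory

/-- The horizontal composite `S ⊗ a` of the identity of `S` and a 2-cell `a`:
`(Σ ⊗ a) ∘ (s ⊗ W)`. -/
def whiskerR {X Y Z : REM B} {W V : X ⟶ Y} (a : W ⟶ V) (S : Y ⟶ Z) : W ≫ S ⟶ V ≫ S where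
  hom := (α_ W.f S.f Z.cell).hom ≫ W.f ◁ S.s ≫ (α_ W.f Y.cell S.f).inv ≫ a.hom ▷ S.f
  isCell₂ := by
    unfold IsCell₂
    have ha := a.comm
    have hS := S.isCell.comul
    have key : ∀ {t : X.base ⟶ Y.base} (c : W.f ≫ Y.cell ⟶ t),
        W.f ◁ S.f ◁ Z.comul ⊗≫ W.f ◁ S.s ▷ Z.cell ⊗≫ (c ▷ (S.f ≫ Z.cell) ≫ t ◁ S.s) =
        W.f ◁ S.s ⊗≫ W.f ◁ Y.comul ▷ S.f ⊗≫ c ▷ (Y.cell ≫ S.f) := by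
      intro t c
      calc _ = W.f ◁ S.f ◁ Z.comul ⊗≫ W.f ◁ S.s ▷ Z.cell ⊗≫ (c ▷ (S.f ≫ Z.cell) ≫ t ◁ S.s) := by
              bicategory
        _ = W.f ◁ (S.f ◁ Z.comul ≫ (α_ S.f Z.cell Z.cell).inv ≫ S.s ▷ Z.cell ≫
              (α_ Y.cell S.f Z.cell).hom ≫ Y.cell ◁ S.s ≫ (α_ Y.cell Y.cell S.f).inv) ⊗≫
              c ▷ (Y.cell ≫ S.f) := by
          rw [← whisker_exchange]; bicategory
        _ = _ := by rw [← hS]; bicategory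
    simp only [comp_f, comp_s]
    calc _ = 𝟙 _ ⊗≫ (W.f ◁ S.f ◁ Z.comul ⊗≫ W.f ◁ S.s ▷ Z.cell ⊗≫
            (W.s ▷ (S.f ≫ Z.cell) ≫ (X.cell ≫ W.f) ◁ S.s)) ⊗≫ X.cell ◁ a.hom ▷ S.f := by bicategory
      _ = 𝟙 _ ⊗≫ W.f ◁ S.s ⊗≫ (W.f ◁ Y.comul ≫ (α_ W.f Y.cell Y.cell).inv ≫ W.s ▷ Y.cell ≫
            (α_ X.cell W.f Y.cell).hom ≫ X.cell ◁ a.hom) ▷ S.f ⊗≫ 𝟙 _ := by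
        rw [key]; bicategory
      _ = 𝟙 _ ⊗≫ (W.f ◁ S.s ⊗≫ W.f ◁ Y.comul ▷ S.f ⊗≫
            a.hom ▷ (Y.cell ≫ S.f)) ⊗≫ V.s ▷ S.f ⊗≫ 𝟙 _ := by
        rw [ha]; bicategory
      _ = _ := by rw [← key]; bicategory

@[simp] theorem whiskerL_hom {X Y Z : REM B} (W : X ⟶ Y) {S T : Y ⟶ Z} (b : S ⟶ T) :
    (whiskerL W b).hom = (α_ W.f S.f Z.cell).hom ≫ W.f ◁ b.hom := rfl
@[simp] theorem whiskerR_hom {X Y Z : REM B} {W V : X ⟶ Y} (a : W ⟶ V) (S : Y ⟶ Z) :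
    (whiskerR a S).hom =
      (α_ W.f S.f Z.cell).hom ≫ W.f ◁ S.s ≫ (α_ W.f Y.cell S.f).inv ≫ a.hom ▷ S.f := rfl

theorem whiskerL_strict {X Y Z : REM B} (W : X ⟶ Y) {S T : Y ⟶ Z} (u : S.f ⟶ T.f)
    (h : S.s ≫ Y.cell ◁ u = u ▷ Z.cell ≫ T.s) :
    (whiskerL W (strict u h)).hom =
      (W ≫ S).f ◁ Z.counit ≫ (ρ_ (W ≫ S).f).hom ≫ W.f ◁ u := by
  simp only [whiskerL_hom, strict_hom, comp_f]; bicategory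

theorem whiskerR_strict {X Y Z : REM B} {W V : X ⟶ Y} (u : W.f ⟶ V.f)
    (h : W.s ≫ X.cell ◁ u = u ▷ Y.cell ≫ V.s) (S : Y ⟶ Z) :
    (whiskerR (strict u h) S).hom =
      (W ≫ S).f ◁ Z.counit ≫ (ρ_ (W ≫ S).f).hom ≫ u ▷ S.f := by
  have hS := S.isCell.counit
  simp only [whiskerR_hom, strict_hom, comp_f]
  calc _ = 𝟙 _ ⊗≫ W.f ◁ (S.s ≫ Y.counit ▷ S.f ≫ (λ_ S.f).hom) ⊗≫ u ▷ S.f := by bicategory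
    _ = _ := by rw [hS]; bicategory

/-- The associativity isomorphism. -/
def assoc {X Y Z V : REM B} (f : X ⟶ Y) (g : Y ⟶ Z) (h : Z ⟶ V) :
    (f ≫ g) ≫ h ≅ f ≫ g ≫ h :=
  isoStrict (α_ f.f g.f h.f) (by simp only [comp_f, comp_s]; bicategory)

/-- The left unit isomorphism. -/
def leftU {X Y : REM B} (f : X ⟶ Y) : 𝟙 X ≫ f ≅ f :=
  isoStrict (λ_ f.f) (by simp only [comp_f, comp_s, id_s, id_f]; bicategory)

/-- The right unit isomorphism. -/
def rightU {X Y : REM B} (f : X ⟶ Y) : f ≫ 𝟙 Y ≅ f :=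
  isoStrict (ρ_ f.f) (by simp only [comp_f, comp_s, id_s, id_f]; bicategory)

/-- The bicategory `REM(B)`. -/
instance : Bicategory (REM B) where
  homCategory := homCategory
  whiskerLeft := whiskerL
  whiskerRight := whiskerR
  associator := assoc
  leftUnitor := leftU
  rightUnitor := rightU
  whiskerLeft_id f g := by ext; simp only [whiskerL_hom, id_hom, comp_f]; bicategory
  whiskerLeft_comp {X Y Z} f {g h i} a b := by
    ext; simp only [whiskerL_hom, comp_hom, comp_f]; bicategory
  id_whiskerLeft {X Y f g} a := by
    ext
    dsimp only [leftU, isoStrict]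
    rw [strict_comp, comp_strict]; simp only [whiskerL_hom, id_f, comp_f]; bicategory
  comp_whiskerLeft {X Y Z V} f g {h h'} a := by
    ext
    dsimp only [assoc, isoStrict]
    rw [strict_comp, comp_strict]; simp only [whiskerL_hom, comp_f]; bicategory
  id_whiskerRight {X Y Z} f g := by
    have hg := g.isCell.counit
    ext; simp only [whiskerR_hom, id_hom, comp_f]
    calc _ = 𝟙 _ ⊗≫ f.f ◁ (g.s ≫ Y.counit ▷ g.f ≫ (λ_ g.f).hom) := by bicategory
      _ = _ := by rw [hg]; bicategory
  comp_whiskerRight {X Y Z f g h} a b i := by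
    have hi := i.isCell.comul
    ext; simp only [whiskerR_hom, comp_hom, comp_f]
    calc _ = 𝟙 _ ⊗≫ f.f ◁ (i.s ≫ Y.comul ▷ i.f) ⊗≫ a.hom ▷ Y.cell ▷ i.f ⊗≫ b.hom ▷ i.f := by
          bicategory
      _ = 𝟙 _ ⊗≫ f.f ◁ i.f ◁ Z.comul ⊗≫ f.f ◁ i.s ▷ Z.cell ⊗≫
            ((f.f ≫ Y.cell) ◁ i.s ≫ a.hom ▷ (Y.cell ≫ i.f)) ⊗≫ b.hom ▷ i.f := by
        rw [hi]; bicategory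
      _ = _ := by rw [whisker_exchange]; bicategory
  whiskerRight_id {X Y f g} a := by
    ext
    dsimp only [rightU, isoStrict]
    rw [strict_comp, comp_strict]; simp only [whiskerR_hom, id_f, id_s, comp_f]; bicategory
  whiskerRight_comp {X Y Z V f f'} a g h := by
    ext
    dsimp only [assoc, isoStrict]
    rw [strict_comp, comp_strict]; simp only [whiskerR_hom, comp_f, comp_s]; bicategory
  whisker_assoc {X Y Z V} f {g g'} a h := by
    ext
    dsimp only [assoc, isoStrict]
    rw [strict_comp, comp_strict]; simp only [whiskerR_hom, whiskerL_hom, comp_f]; bicategory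
  whisker_exchange {X Y Z f g h i} a b := by
    have hb := b.comm
    ext; simp only [whiskerR_hom, whiskerL_hom, comp_hom, comp_f]
    calc _ = 𝟙 _ ⊗≫ f.f ◁ (h.f ◁ Z.comul ≫ (α_ h.f Z.cell Z.cell).inv ≫ b.hom ▷ Z.cell ≫ i.s) ⊗≫
            a.hom ▷ i.f := by bicategory
      _ = 𝟙 _ ⊗≫ f.f ◁ h.f ◁ Z.comul ⊗≫ f.f ◁ h.s ▷ Z.cell ⊗≫
            ((f.f ≫ Y.cell) ◁ b.hom ≫ a.hom ▷ i.f) := by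
        rw [← hb]; bicategory
      _ = _ := by rw [whisker_exchange]; bicategory
  pentagon {a b c d e} f g h i := by
    ext
    dsimp only [assoc, isoStrict]
    rw [strict_comp, comp_hom, whiskerR_strict, strict_comp, whiskerL_strict, strict_hom]
    have := REM.counit_strict e (((f ≫ g) ≫ h) ≫ i).f ((α_ f.f g.f h.f).hom ▷ i.f)
    simp only [comp_f] at this ⊢
    rw [reassoc_of% this]; bicategory
  triangle f g := by
    ext
    dsimp only [assoc, isoStrict, leftU, rightU]
    rw [strict_comp, whiskerR_strict, whiskerL_strict]
    simp only [comp_f, id_f]; bicategory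
end REM

section BalancedTensor
open scoped TensorProduct

variable (A : Type u) [Ring A] (M N : Type u) [AddCommGroup M] [AddCommGroup N]
  [Module Aᵐᵒᵖ M] [Module A N]

/-- The abelian group `M ⊗_A N`, for a right module `M` and a left module `N` over a ring `A`: the
quotient of `M ⊗_ℤ N` by the subgroup spanned by the elements `m a ⊗ n - m ⊗ a n`. -/
def Bal : Type u :=
  (M ⊗[ℤ] N) ⧸ Submodule.span ℤ
    {t : M ⊗[ℤ] N | ∃ (m : M) (a : A) (n : N), t = (op a • m) ⊗ₜ[ℤ] n - m ⊗ₜ[ℤ] (a • n)}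

instance : AddCommGroup (Bal A M N) := by unfold Bal; infer_instance

namespace Bal
variable {M N}

/-- The element `m ⊗ n`. -/
def tmul (m : M) (n : N) : Bal A M N := Submodule.Quotient.mk (m ⊗ₜ[ℤ] n)

variable {A}

theorem tmul_add (m : M) (n n' : N) : tmul A m (n + n') = tmul A m n + tmul A m n' :=
  congrArg Submodule.Quotient.mk (TensorProduct.tmul_add m n n')
theorem add_tmul (m m' : M) (n : N) : tmul A (m + m') n = tmul A m n + tmul A m' n :=
  congrArg Submodule.Quotient.mk (TensorProduct.add_tmul m m' n)
theorem balanced (m : M) (a : A) (n : N) : tmul A (op a • m) n = tmul A m (a • n) :=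
  (Submodule.Quotient.eq _).2 (Submodule.subset_span ⟨m, a, n, rfl⟩)

theorem induction {p : Bal A M N → Prop} (h : ∀ m n, p (tmul A m n))
    (hadd : ∀ x y, p x → p y → p (x + y)) (x : Bal A M N) : p x := by
  obtain ⟨t, rfl⟩ := Submodule.Quotient.mk_surjective _ x
  induction t using TensorProduct.induction_on with
  | zero =>
    have := h 0 0
    rwa [tmul, TensorProduct.tmul_zero] at this
  | tmul m n => exact h m n
  | add x y hx hy => exact hadd _ _ hx hy

/-- The additive map out of `M ⊗_A N` given by a biadditive balanced map. -/
def lift {P : Type*} [AddCommGroup P] (f : M → N → P)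
    (h₁ : ∀ m m' n, f (m + m') n = f m n + f m' n)
    (h₂ : ∀ m n n', f m (n + n') = f m n + f m n')
    (h₃ : ∀ m (a : A) n, f (op a • m) n = f m (a • n)) : Bal A M N →+ P :=
  let g : M →+ N →+ P := AddMonoidHom.mk' (fun m => AddMonoidHom.mk' (f m) (h₂ m))
    (fun m m' => by ext n; exact h₁ m m' n)
  (Submodule.liftQ _ (TensorProduct.liftAddHom g (fun r m n => by simp)).toIntLinearMap (by
    rw [Submodule.span_le]
    rintro _ ⟨m, a, n, rfl⟩
    have : f (op a • m) n - f m (a • n) = 0 := by rw [h₃, sub_self]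
    simpa [g] using this)).toAddMonoidHom

@[simp] theorem lift_tmul {P : Type*} [AddCommGroup P] (f : M → N → P) (h₁ h₂ h₃) (m : M) (n : N) :
    lift (A := A) f h₁ h₂ h₃ (tmul A m n) = f m n := by
  rfl

theorem hom_ext {P : Type*} [AddCommGroup P] {f g : Bal A M N →+ P}
    (h : ∀ m n, f (tmul A m n) = g (tmul A m n)) : f = g := by
  ext x
  induction x using induction with
  | h m n => exact h m n
  | hadd x y hx hy => simp [hx, hy]

@[simp] theorem zero_tmul (n : N) : tmul A (0 : M) n = 0 := by
  have := add_tmul (A := A) (0 : M) 0 n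
  simpa using this
@[simp] theorem tmul_zero (m : M) : tmul A m (0 : N) = 0 := by
  have := tmul_add (A := A) m (0 : N) 0
  simpa using this

theorem sum_tmul {ι : Type*} (s : Finset ι) (m : ι → M) (n : N) :
    tmul A (∑ i ∈ s, m i) n = ∑ i ∈ s, tmul A (m i) n :=
  map_sum (AddMonoidHom.mk' (fun m => tmul A m n) (fun m m' => add_tmul m m' n)) m s
theorem tmul_sum {ι : Type*} (s : Finset ι) (m : M) (n : ι → N) :
    tmul A m (∑ i ∈ s, n i) = ∑ i ∈ s, tmul A m (n i) :=
  map_sum (AddMonoidHom.mk' (fun n => tmul A m n) (fun n n' => tmul_add m n n')) n s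

/-- The left action `b (m ⊗ n) = (b m) ⊗ n`. -/
@[reducible] def leftModule (B : Type u) [Ring B] [Module B M] [SMulCommClass B Aᵐᵒᵖ M] :
    Module B (Bal A M N) :=
  let act (b : B) : Bal A M N →+ Bal A M N := lift (fun m n => tmul A (b • m) n)
    (fun m m' n => by rw [smul_add, add_tmul]) (fun m n n' => by rw [tmul_add])
    (fun m a n => by rw [smul_comm, balanced])
  { smul b x := act b x
    one_smul := DFunLike.congr_fun (f := act 1) (g := AddMonoidHom.id _)
      (hom_ext fun m n => by simp [act])
    mul_smul b b' := DFunLike.congr_fun (f := act (b * b')) (g := (act b).comp (act b'))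
      (hom_ext fun m n => by simp [act, mul_smul])
    smul_zero b := map_zero (act b)
    smul_add b := map_add (act b)
    add_smul b b' := DFunLike.congr_fun (f := act (b + b')) (g := act b + act b')
      (hom_ext fun m n => by simp [act, add_smul, add_tmul])
    zero_smul := DFunLike.congr_fun (f := act 0) (g := 0)
      (hom_ext fun m n => by simp [act]) }

/-- The right action `(m ⊗ n) c = m ⊗ (n c)`. -/
@[reducible] def rightModule (C : Type u) [Ring C] [Module Cᵐᵒᵖ N] [SMulCommClass A Cᵐᵒᵖ N] :
    Module Cᵐᵒᵖ (Bal A M N) :=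
  let act (c : Cᵐᵒᵖ) : Bal A M N →+ Bal A M N := lift (fun m n => tmul A m (c • n))
    (fun m m' n => by rw [add_tmul]) (fun m n n' => by rw [smul_add, tmul_add])
    (fun m a n => by rw [← smul_comm, balanced])
  { smul c x := act c x
    one_smul := DFunLike.congr_fun (f := act 1) (g := AddMonoidHom.id _)
      (hom_ext fun m n => by simp [act])
    mul_smul b b' := DFunLike.congr_fun (f := act (b * b')) (g := (act b).comp (act b'))
      (hom_ext fun m n => by simp [act, mul_smul])
    smul_zero b := map_zero (act b)
    smul_add b := map_add (act b)
    add_smul b b' := DFunLike.congr_fun (f := act (b + b')) (g := act b + act b')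
      (hom_ext fun m n => by simp [act, add_smul, tmul_add])
    zero_smul := DFunLike.congr_fun (f := act 0) (g := 0)
      (hom_ext fun m n => by simp [act]) }

end Bal
end BalancedTensor

/-- The objects of the bicategory of bimodules: (unital, associative) `k`-algebras. -/
structure Bim (k : Type v) [CommRing k] where
  carrier : Type u
  [ring : Ring carrier]
  [algebra : Algebra k carrier]

namespace Bim
variable {k : Type v} [CommRing k]
instance : CoeSort (Bim.{u} k) (Type u) := ⟨carrier⟩
attribute [instance] ring algebra

/-- `(A, B)`-bimodules over `k`: left `A`-modules that are right `B`-modules (that is, left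
`Bᵐᵒᵖ`-modules), with commuting actions which induce the same action of `k`. -/
structure Bimodule (A B : Bim.{u} k) where
  carrier : Type u
  [addCommGroup : AddCommGroup carrier]
  [left : Module A carrier]
  [right : Module Bᵐᵒᵖ carrier]
  [comm : SMulCommClass A Bᵐᵒᵖ carrier]
  central : ∀ (c : k) (m : carrier), algebraMap k A c • m = op (algebraMap k B c) • m

namespace Bimodule
variable {A B C D : Bim.{u} k}
instance : CoeSort (Bimodule A B) (Type u) := ⟨carrier⟩
attribute [instance] addCommGroup left right comm

/-- Bilinear maps of bimodules. -/
@[ext]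
structure BiHom (M N : Bimodule A B) extends M →+ N where
  map_smul : ∀ (a : A) (m : M), toFun (a • m) = a • toFun m
  map_op_smul : ∀ (b : B) (m : M), toFun (op b • m) = op b • toFun m

instance (M N : Bimodule A B) : FunLike (BiHom M N) M N where
  coe f := f.toFun
  coe_injective f g h := by
    cases f; cases g; congr; exact DFunLike.coe_injective h

instance (M N : Bimodule A B) : AddMonoidHomClass (BiHom M N) M N where
  map_add f := f.map_add'
  map_zero f := f.map_zero'

theorem BiHom.smul {M N : Bimodule A B} (f : BiHom M N) (a : A) (m : M) : f (a • m) = a • f m :=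
  f.map_smul a m
theorem BiHom.op_smul {M N : Bimodule A B} (f : BiHom M N) (b : B) (m : M) :
    f (op b • m) = op b • f m := f.map_op_smul b m

instance : Category (Bimodule A B) where
  Hom := BiHom
  id M := { AddMonoidHom.id M with map_smul := fun _ _ => rfl, map_op_smul := fun _ _ => rfl }
  comp f g :=
    { g.toAddMonoidHom.comp f.toAddMonoidHom with
      map_smul := fun a m => (congrArg g (f.smul a m)).trans (g.smul a _)
      map_op_smul := fun a m => (congrArg g (f.op_smul a m)).trans (g.op_smul a _) }

instance (M N : Bimodule A B) : FunLike (M ⟶ N) M N := inferInstanceAs (FunLike (BiHom M N) M N)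
instance (M N : Bimodule A B) : AddMonoidHomClass (M ⟶ N) M N :=
  inferInstanceAs (AddMonoidHomClass (BiHom M N) M N)

theorem hom_smul {M N : Bimodule A B} (f : M ⟶ N) (a : A) (m : M) : f (a • m) = a • f m :=
  f.map_smul a m
theorem hom_op_smul {M N : Bimodule A B} (f : M ⟶ N) (b : B) (m : M) :
    f (op b • m) = op b • f m := f.map_op_smul b m
@[simp] theorem id_apply (M : Bimodule A B) (m : M) : (𝟙 M : M ⟶ M) m = m := rfl
@[simp] theorem comp_apply {M N P : Bimodule A B} (f : M ⟶ N) (g : N ⟶ P) (m : M) :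
    (f ≫ g) m = g (f m) := rfl
theorem hom_ext {M N : Bimodule A B} {f g : M ⟶ N} (h : ∀ m, f m = g m) : f = g :=
  DFunLike.ext f g h

/-- The regular bimodule. -/
def regular (A : Bim.{u} k) : Bimodule A A where
  carrier := A
  central c a := by simp [Algebra.commutes]

/-- The tensor product `M ⊗_B N` of an `(A, B)`-bimodule and a `(B, C)`-bimodule. -/
def tensor (M : Bimodule A B) (N : Bimodule B C) : Bimodule A C :=
  letI := Bal.leftModule (A := B) (M := M) (N := N) A
  letI := Bal.rightModule (A := B) (M := M) (N := N) C
  { carrier := Bal B M N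
    comm := ⟨fun a c x => by
      induction x using Bal.induction with
      | h m n => rfl
      | hadd x y hx hy => simp only [smul_add, hx, hy]⟩
    central := fun c x => by
      induction x using Bal.induction with
      | h m n => 
        change Bal.tmul B (algebraMap k A c • m) n = Bal.tmul B m (op (algebraMap k C c) • n)
        rw [M.central, Bal.balanced, N.central]
      | hadd x y hx hy => simp only [smul_add, hx, hy] }

/-- The element `m ⊗ n`. -/
def tmul {M : Bimodule A B} {N : Bimodule B C} (m : M) (n : N) : M.tensor N := Bal.tmul B m n

section
variable {M : Bimodule A B} {N : Bimodule B C}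
theorem smul_tmul (a : A) (m : M) (n : N) : a • tmul m n = tmul (a • m) n := rfl
theorem op_smul_tmul (c : C) (m : M) (n : N) : op c • tmul m n = tmul m (op c • n) := rfl
theorem balanced (b : B) (m : M) (n : N) : tmul (op b • m) n = tmul m (b • n) :=
  Bal.balanced m b n
theorem add_tmul (m m' : M) (n : N) : tmul (m + m') n = tmul m n + tmul m' n :=
  Bal.add_tmul m m' n
theorem tmul_add (m : M) (n n' : N) : tmul m (n + n') = tmul m n + tmul m n' :=
  Bal.tmul_add m n n'
theorem zero_tmul (n : N) : tmul (0 : M) n = 0 := Bal.zero_tmul n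
theorem tmul_zero (m : M) : tmul m (0 : N) = 0 := Bal.tmul_zero m
theorem sum_tmul {ι : Type*} (s : Finset ι) (m : ι → M) (n : N) :
    tmul (∑ i ∈ s, m i) n = ∑ i ∈ s, tmul (m i) n := Bal.sum_tmul s m n
theorem tmul_sum {ι : Type*} (s : Finset ι) (m : M) (n : ι → N) :
    tmul m (∑ i ∈ s, n i) = ∑ i ∈ s, tmul m (n i) := Bal.tmul_sum s m n

@[elab_as_elim]
theorem tensor_induction {p : M.tensor N → Prop} (x : M.tensor N) (tmul : ∀ m n, p (tmul m n))
    (add : ∀ x y, p x → p y → p (x + y)) : p x := Bal.induction tmul add x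

/-- The bilinear map out of `M ⊗ N` given by a balanced, bilinear map of two variables. -/
def lift {P : Bimodule A C} (f : M → N → P)
    (h₁ : ∀ m m' n, f (m + m') n = f m n + f m' n)
    (h₂ : ∀ m n n', f m (n + n') = f m n + f m n')
    (h₃ : ∀ m (b : B) n, f (op b • m) n = f m (b • n))
    (h₄ : ∀ (a : A) m n, f (a • m) n = a • f m n)
    (h₅ : ∀ m n (c : C), f m (op c • n) = op c • f m n) : M.tensor N ⟶ P :=
  let F : M.tensor N →+ P := Bal.lift f h₁ h₂ h₃
  have hF (m n) : F (tmul m n) = f m n := Bal.lift_tmul f h₁ h₂ h₃ m n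
  { toAddMonoidHom := F
    map_smul := fun a x => by
      change F (a • x) = a • F x
      induction x using tensor_induction with
      | tmul m n => rw [smul_tmul, hF, hF, h₄]
      | add x y hx hy => rw [smul_add, map_add, map_add, smul_add, hx, hy]
    map_op_smul := fun c x => by
      change F (op c • x) = op c • F x
      induction x using tensor_induction with
      | tmul m n => rw [op_smul_tmul, hF, hF, h₅]
      | add x y hx hy => rw [smul_add, map_add, map_add, smul_add, hx, hy] }

@[simp] theorem lift_tmul {P : Bimodule A C} (f : M → N → P) (h₁ h₂ h₃ h₄ h₅) (m : M) (n : N) :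
    (lift f h₁ h₂ h₃ h₄ h₅ : M.tensor N ⟶ P) (tmul m n) = f m n :=
  Bal.lift_tmul (A := B) f h₁ h₂ h₃ m n

theorem tensor_hom_ext {P : Bimodule A C} {f g : M.tensor N ⟶ P}
    (h : ∀ m n, f (tmul m n) = g (tmul m n)) : f = g :=
  hom_ext fun x => by
    induction x using tensor_induction with
    | tmul m n => exact h m n
    | add x y hx hy => rw [map_add, map_add, hx, hy]
end

/-- The map `f ⊗ g`. -/
def map {M M' : Bimodule A B} {N N' : Bimodule B C} (f : M ⟶ M') (g : N ⟶ N') :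
    M.tensor N ⟶ M'.tensor N' :=
  lift (fun m n => tmul (f m) (g n))
    (fun m m' n => by rw [map_add, add_tmul]) (fun m n n' => by rw [map_add, tmul_add])
    (fun m b n => by rw [hom_op_smul, balanced, hom_smul])
    (fun a m n => by rw [hom_smul, smul_tmul]) (fun m n c => by rw [hom_op_smul, op_smul_tmul])

@[simp] theorem map_tmul {M M' : Bimodule A B} {N N' : Bimodule B C} (f : M ⟶ M') (g : N ⟶ N')
    (m : M) (n : N) : map f g (tmul m n) = tmul (f m) (g n) := lift_tmul ..

theorem hom_ext₃ {M : Bimodule A B} {N : Bimodule B C} {P : Bimodule C D} {Q : Bimodule A D}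
    {f g : M.tensor (N.tensor P) ⟶ Q}
    (h : ∀ m n p, f (tmul m (tmul n p)) = g (tmul m (tmul n p))) : f = g :=
  tensor_hom_ext fun m x => by
    induction x using tensor_induction with
    | tmul n p => exact h m n p
    | add x y hx hy => rw [tmul_add, map_add, map_add, hx, hy]

theorem hom_ext₃' {M : Bimodule A B} {N : Bimodule B C} {P : Bimodule C D} {Q : Bimodule A D}
    {f g : (M.tensor N).tensor P ⟶ Q}
    (h : ∀ m n p, f (tmul (tmul m n) p) = g (tmul (tmul m n) p)) : f = g :=
  tensor_hom_ext fun x p => by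
    induction x using tensor_induction with
    | tmul m n => exact h m n p
    | add x y hx hy => rw [add_tmul, map_add, map_add, hx, hy]

/-- The map `n ⊗ p ↦ (m ⊗ n) ⊗ p` as an additive map. -/
def assocAux {M : Bimodule A B} {N : Bimodule B C} {P : Bimodule C D} (m : M) :
    N.tensor P →+ (M.tensor N).tensor P :=
  Bal.lift (fun n p => tmul (tmul m n) p) (fun n n' p => by rw [tmul_add, add_tmul])
    (fun n p p' => by rw [tmul_add]) (fun n c p => by rw [← op_smul_tmul, balanced])

theorem assocAux_tmul {M : Bimodule A B} {N : Bimodule B C} {P : Bimodule C D} (m : M) (n : N)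
    (p : P) : assocAux m (tmul n p) = tmul (tmul m n) p := Bal.lift_tmul ..

/-- The map `m ⊗ n ↦ m ⊗ (n ⊗ p)` as an additive map. -/
def assocAux' {M : Bimodule A B} {N : Bimodule B C} {P : Bimodule C D} (p : P) :
    M.tensor N →+ M.tensor (N.tensor P) :=
  Bal.lift (fun m n => tmul m (tmul n p)) (fun m m' n => by rw [add_tmul])
    (fun m n n' => by rw [add_tmul, tmul_add]) (fun m c n => by rw [balanced, smul_tmul])

theorem assocAux'_tmul {M : Bimodule A B} {N : Bimodule B C} {P : Bimodule C D} (m : M) (n : N)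
    (p : P) : assocAux' p (tmul m n) = tmul m (tmul n p) := Bal.lift_tmul ..

/-- The isomorphism `M ⊗ (N ⊗ P) ≅ (M ⊗ N) ⊗ P`. -/
def assoc (M : Bimodule A B) (N : Bimodule B C) (P : Bimodule C D) :
    M.tensor (N.tensor P) ≅ (M.tensor N).tensor P where
  hom := lift (fun m x => assocAux m x)
    (fun m m' x => by
      induction x using tensor_induction with
      | tmul n p => simp only [assocAux_tmul, add_tmul]
      | add x y hx hy => simp only [map_add, hx, hy]; abel)
    (fun m x y => map_add _ _ _)
    (fun m b x => by
      induction x using tensor_induction with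
      | tmul n p => simp only [assocAux_tmul, smul_tmul, balanced]
      | add x y hx hy => simp only [map_add, smul_add, hx, hy])
    (fun a m x => by
      induction x using tensor_induction with
      | tmul n p => simp only [assocAux_tmul, smul_tmul]
      | add x y hx hy => simp only [map_add, smul_add, hx, hy])
    (fun m x c => by
      induction x using tensor_induction with
      | tmul n p => simp only [assocAux_tmul, op_smul_tmul]
      | add x y hx hy => simp only [map_add, smul_add, hx, hy])
  inv := lift (fun x p => assocAux' p x)
    (fun x y p => map_add _ _ _)
    (fun x p p' => by
      induction x using tensor_induction with
      | tmul m n => simp only [assocAux'_tmul, tmul_add]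
      | add x y hx hy => simp only [map_add, hx, hy]; abel)
    (fun x c p => by
      induction x using tensor_induction with
      | tmul m n => simp only [assocAux'_tmul, op_smul_tmul, balanced]
      | add x y hx hy => simp only [map_add, smul_add, hx, hy])
    (fun a x p => by
      induction x using tensor_induction with
      | tmul m n => simp only [assocAux'_tmul, smul_tmul]
      | add x y hx hy => simp only [map_add, smul_add, hx, hy])
    (fun x p c => by
      induction x using tensor_induction with
      | tmul m n => simp only [assocAux'_tmul, op_smul_tmul]
      | add x y hx hy => simp only [map_add, smul_add, hx, hy])
  hom_inv_id := hom_ext₃ fun m n p => by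
    simp only [comp_apply, lift_tmul, assocAux_tmul, assocAux'_tmul, id_apply]
  inv_hom_id := hom_ext₃' fun m n p => by
    simp only [comp_apply, lift_tmul, assocAux_tmul, assocAux'_tmul, id_apply]

@[simp] theorem assoc_hom_tmul {M : Bimodule A B} {N : Bimodule B C} {P : Bimodule C D} (m : M)
    (n : N) (p : P) : (assoc M N P).hom (tmul m (tmul n p)) = tmul (tmul m n) p :=
  by
  unfold assoc; simp only [lift_tmul, assocAux_tmul]
@[simp] theorem assoc_inv_tmul {M : Bimodule A B} {N : Bimodule B C} {P : Bimodule C D} (m : M)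
    (n : N) (p : P) : (assoc M N P).inv (tmul (tmul m n) p) = tmul m (tmul n p) :=
  by
  unfold assoc; simp only [lift_tmul, assocAux'_tmul]

/-- `a ∈ A` as an element of the regular bimodule. -/
def toRegular (a : A) : regular A := a
/-- An element of the regular bimodule as an element of `A`. -/
def ofRegular (a : regular A) : A := a

theorem toRegular_mul (a b : A) : toRegular (a * b) = a • toRegular b := rfl
theorem toRegular_mul' (a b : A) : toRegular (a * b) = op b • toRegular a := rfl

/-- The isomorphism `A ⊗_A M ≅ M`. -/
def regularTensor (M : Bimodule A B) : (regular A).tensor M ≅ M where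
  hom := lift (fun a m => ofRegular a • m) (fun a a' m => add_smul (ofRegular a) (ofRegular a') m)
    (fun a m m' => smul_add (ofRegular a) m m') (fun a b m => mul_smul (ofRegular a) b m)
    (fun a b m => mul_smul a (ofRegular b) m) (fun a m b => smul_comm (ofRegular a) (op b) m)
  inv :=
    { toFun := fun m => tmul (toRegular 1) m
      map_zero' := tmul_zero _
      map_add' := fun m m' => tmul_add _ _ _
      map_smul := fun a m => by
        rw [smul_tmul, ← balanced, ← toRegular_mul, ← toRegular_mul', mul_one, one_mul]
      map_op_smul := fun b m => rfl }
  hom_inv_id := tensor_hom_ext fun a m => by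
    rw [comp_apply, id_apply]
    refine (congrArg (tmul (toRegular 1)) (lift_tmul _ _ _ _ _ _ a m)).trans ?_
    rw [← balanced, ← toRegular_mul', one_mul]
    rfl
  inv_hom_id := hom_ext fun m => by
    rw [comp_apply]
    exact (lift_tmul _ _ _ _ _ _ (toRegular (1 : A)) m).trans (one_smul A m)

/-- The isomorphism `M ⊗_B B ≅ M`. -/
def tensorRegular (M : Bimodule A B) : M.tensor (regular B) ≅ M where
  hom := lift (fun m b => op (ofRegular b) • m) (fun m m' b => smul_add (op (ofRegular b)) m m')
    (fun m b b' => add_smul (op (ofRegular b)) (op (ofRegular b')) m)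
    (fun m b b' => (mul_smul (op (ofRegular b')) (op b) m).symm)
    (fun a m b => (smul_comm a (op (ofRegular b)) m).symm)
    (fun m b b' => mul_smul (op b') (op (ofRegular b)) m)
  inv :=
    { toFun := fun m => tmul m (toRegular 1)
      map_zero' := zero_tmul _
      map_add' := fun m m' => add_tmul _ _ _
      map_smul := fun a m => rfl
      map_op_smul := fun b m => by
        rw [op_smul_tmul, balanced, ← toRegular_mul, ← toRegular_mul', mul_one, one_mul] }
  hom_inv_id := tensor_hom_ext fun m b => by
    rw [comp_apply, id_apply]
    refine (congrArg (tmul · (toRegular 1)) (lift_tmul _ _ _ _ _ _ m b)).trans ?_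
    rw [balanced, ← toRegular_mul, mul_one]
    rfl
  inv_hom_id := hom_ext fun m => by
    rw [comp_apply]
    exact (lift_tmul _ _ _ _ _ _ m (toRegular (1 : B))).trans (one_smul Bᵐᵒᵖ m)

@[simp] theorem regularTensor_tmul (M : Bimodule A B) (a : regular A) (m : M) :
    (regularTensor M).hom (tmul a m) = ofRegular a • m :=
  lift_tmul (fun (a : regular A) m => ofRegular a • m) _ _ _
    (fun a b m => mul_smul a (ofRegular b) m) (fun a m b => smul_comm (ofRegular a) (op b) m) a m
@[simp] theorem tensorRegular_tmul (M : Bimodule A B) (b : regular B) (m : M) :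
    (tensorRegular M).hom (tmul m b) = op (ofRegular b) • m :=
  lift_tmul (fun m (b : regular B) => op (ofRegular b) • m) _ _ _
    (fun a m b => (smul_comm a (op (ofRegular b)) m).symm)
    (fun m b b' => mul_smul (op b') (op (ofRegular b)) m) m b

theorem map_id (M : Bimodule A B) (N : Bimodule B C) : map (𝟙 M) (𝟙 N) = 𝟙 (M.tensor N) :=
  tensor_hom_ext fun m n => by simp

theorem map_comp {M M' M'' : Bimodule A B} {N N' N'' : Bimodule B C} (f : M ⟶ M') (f' : M' ⟶ M'')
    (g : N ⟶ N') (g' : N' ⟶ N'') : map (f ≫ f') (g ≫ g') = map f g ≫ map f' g' :=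
  tensor_hom_ext fun m n => by simp

theorem assoc_naturality {M M' : Bimodule A B} {N N' : Bimodule B C} {P P' : Bimodule C D}
    (f : M ⟶ M') (g : N ⟶ N') (h : P ⟶ P') :
    map f (map g h) ≫ (assoc M' N' P').hom = (assoc M N P).hom ≫ map (map f g) h :=
  hom_ext₃ fun m n p => by simp

theorem regularTensor_naturality {M M' : Bimodule A B} (f : M ⟶ M') :
    map (𝟙 (regular A)) f ≫ (regularTensor M').hom = (regularTensor M).hom ≫ f :=
  tensor_hom_ext fun a m => by
    simp only [comp_apply, map_tmul, id_apply, regularTensor_tmul, hom_smul]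

theorem tensorRegular_naturality {M M' : Bimodule A B} (f : M ⟶ M') :
    map f (𝟙 (regular B)) ≫ (tensorRegular M').hom = (tensorRegular M).hom ≫ f :=
  tensor_hom_ext fun m b => by
    simp only [comp_apply, map_tmul, id_apply, tensorRegular_tmul, hom_op_smul]

theorem assoc_pentagon {E : Bim.{u} k} (M : Bimodule A B) (N : Bimodule B C) (P : Bimodule C D)
    (Q : Bimodule D E) :
    map (𝟙 M) (assoc N P Q).hom ≫ (assoc M (N.tensor P) Q).hom ≫ map (assoc M N P).hom (𝟙 Q) =
      (assoc M N (P.tensor Q)).hom ≫ (assoc (M.tensor N) P Q).hom :=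
  tensor_hom_ext fun m x => by
    induction x using tensor_induction with
    | add x y hx hy => rw [tmul_add, map_add, map_add, hx, hy]
    | tmul n x =>
      induction x using tensor_induction with
      | add x y hx hy => rw [tmul_add, tmul_add, map_add, map_add, hx, hy]
      | tmul p q => simp

theorem assoc_triangle (M : Bimodule A B) (N : Bimodule B C) :
    (assoc M (regular B) N).hom ≫ map (tensorRegular M).hom (𝟙 N) =
      map (𝟙 M) (regularTensor N).hom :=
  hom_ext₃ fun m b n => by
    simp only [comp_apply, assoc_hom_tmul, map_tmul, tensorRegular_tmul, regularTensor_tmul,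
      id_apply, balanced]
end Bimodule

open Bimodule

/-- A 1-cell from `A` to `B` is a `(B, A)`-bimodule, the composite of `f : A ⟶ B` and `g : B ⟶ C` is
`g ⊗_B f`, and the identity 1-cell of `A` is the regular bimodule. -/
instance : CategoryStruct (Bim.{u} k) where
  Hom A B := Bimodule B A
  id A := regular A
  comp f g := g.tensor f

instance homCategory (A B : Bim.{u} k) : Category (A ⟶ B) :=
  inferInstanceAs (Category (Bimodule B A))

/-- The bicategory of bimodules. -/
instance : Bicategory (Bim.{u} k) where
  homCategory := homCategory
  whiskerLeft f _ _ η := Bimodule.map η (𝟙 f)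
  whiskerRight η h := Bimodule.map (𝟙 h) η
  associator f g h := assoc h g f
  leftUnitor f := tensorRegular f
  rightUnitor f := regularTensor f
  whiskerLeft_id f g := Bimodule.map_id g f
  whiskerLeft_comp f _ _ _ η θ := Bimodule.map_comp η θ (𝟙 f) (𝟙 f)
  id_whiskerLeft η := by
    rw [← Category.assoc, Iso.eq_comp_inv]
    exact tensorRegular_naturality η
  comp_whiskerLeft f g _ _ η := by
    rw [← Category.assoc, Iso.eq_comp_inv, ← Bimodule.assoc_naturality, Bimodule.map_id]
    rfl
  id_whiskerRight f g := Bimodule.map_id g f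
  comp_whiskerRight η θ i := Bimodule.map_comp (𝟙 i) (𝟙 i) η θ
  whiskerRight_id η := by
    rw [← Category.assoc, Iso.eq_comp_inv]
    exact regularTensor_naturality η
  whiskerRight_comp η g h := by
    rw [Iso.eq_inv_comp]
    refine (congrArg (fun x => _ ≫ Bimodule.map x η) (Bimodule.map_id h g).symm).trans ?_
    exact (assoc_naturality (𝟙 h) (𝟙 g) η).symm
  whisker_assoc f _ _ η h := by
    rw [← Category.assoc, Iso.eq_comp_inv]
    exact assoc_naturality (𝟙 h) η (𝟙 f)
  whisker_exchange η θ :=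
    (Bimodule.map_comp θ (𝟙 _) (𝟙 _) η).symm.trans (Bimodule.map_comp (𝟙 _) θ η (𝟙 _))
  pentagon f g h i := assoc_pentagon i h g f
  triangle f g := assoc_triangle g f
end Bim

/-! ### Duals and finitely generated projective bimodules -/

theorem finite_projective_iff (R : Type u) [Ring R] (M : Type u) [AddCommGroup M] [Module R M] :
    (Module.Finite R M ∧ Module.Projective R M) ↔
      ∃ (n : ℕ) (e : Fin n → M) (e' : Fin n → M →ₗ[R] R), ∀ x, ∑ i, e' i x • e i = x := by
  classical
  constructor
  · rintro ⟨h1, h2⟩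
    obtain ⟨n, f, g, -, -, hfg⟩ := Module.Finite.exists_comp_eq_id_of_projective R M
    refine ⟨n, fun i => f (Pi.single i 1), fun i => (LinearMap.proj i).comp g, fun x => ?_⟩
    have h := LinearMap.congr_fun hfg x
    simp only [LinearMap.comp_apply, LinearMap.id_apply] at h
    conv_rhs => rw [← h, ← Finset.univ_sum_single (g x), map_sum]
    refine Finset.sum_congr rfl fun i _ => ?_
    rw [LinearMap.comp_apply, LinearMap.proj_apply, ← map_smul, ← Pi.single_smul, smul_eq_mul,
      mul_one]
  · rintro ⟨n, e, e', h⟩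
    refine ⟨⟨⟨Finset.univ.image e, ?_⟩⟩, ?_⟩
    · refine Submodule.eq_top_iff'.2 fun x => ?_
      rw [← h x]
      exact Submodule.sum_mem _ fun i _ => Submodule.smul_mem _ _
        (Submodule.subset_span (by simp))
    · refine Module.Projective.of_split (LinearMap.pi e') (Fintype.linearCombination R e) ?_
      ext x
      simpa [Fintype.linearCombination_apply] using h x

namespace Bim
variable {k : Type v} [CommRing k]
namespace Bimodule
variable {A B C : Bim.{u} k}

/-- The underlying right module is finitely generated and projective. -/
def IsRightFGP (M : Bimodule B A) : Prop := Module.Finite Aᵐᵒᵖ M ∧ Module.Projective Aᵐᵒᵖ M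

/-- The underlying left module is finitely generated and projective. -/
def IsLeftFGP (M : Bimodule A B) : Prop := Module.Finite A M ∧ Module.Projective A M

/-- The right dual `M* = Hom_A(M_A, A_A)` of a `(B, A)`-bimodule, with the `(A, B)`-bimodule
structure `(a φ b)(x) = a φ(b x)`. -/
def dual (M : Bimodule B A) : Bimodule A B :=
  letI : Module Bᵐᵒᵖ (M →ₗ[Aᵐᵒᵖ] A) :=
    { smul b φ :=
        { toFun := fun x => φ (b.unop • x)
          map_add' := fun x y => by rw [smul_add, map_add]
          map_smul' := fun a x => by rw [smul_comm, map_smul]; rfl }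
      one_smul φ := LinearMap.ext fun x => congrArg φ (one_smul B x)
      mul_smul b b' φ := LinearMap.ext fun x => congrArg φ (mul_smul b'.unop b.unop x)
      smul_zero b := rfl
      smul_add b φ ψ := rfl
      add_smul b b' φ := LinearMap.ext fun x =>
        (congrArg φ (add_smul b.unop b'.unop x)).trans (map_add φ _ _)
      zero_smul φ := LinearMap.ext fun x => (congrArg φ (zero_smul B x)).trans (map_zero φ) }
  { carrier := M →ₗ[Aᵐᵒᵖ] A
    comm := ⟨fun _ _ _ => rfl⟩
    central := fun c φ => LinearMap.ext fun x => by
      change algebraMap k A c * φ x = φ (algebraMap k B c • x)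
      rw [M.central, map_smul, Algebra.commutes]
      rfl }

instance (M : Bimodule B A) : FunLike (dual M) M A :=
  inferInstanceAs (FunLike (M →ₗ[Aᵐᵒᵖ] A) M A)
instance (M : Bimodule B A) : AddMonoidHomClass (dual M) M A :=
  inferInstanceAs (AddMonoidHomClass (M →ₗ[Aᵐᵒᵖ] A) M A)

section
variable {M : Bimodule B A}
theorem dual_ext {φ ψ : dual M} (h : ∀ x, φ x = ψ x) : φ = ψ := DFunLike.ext φ ψ h
theorem dual_map_op_smul (φ : dual M) (a : A) (x : M) : φ (op a • x) = φ x * a :=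
  LinearMap.map_smul (M := M) (M₂ := A) φ (op a) x
theorem dual_add (φ ψ : dual M) (x : M) : (φ + ψ) x = φ x + ψ x := rfl
theorem dual_zero (x : M) : (0 : dual M) x = 0 := rfl
theorem dual_smul (a : A) (φ : dual M) (x : M) : (a • φ) x = a * φ x := rfl
theorem dual_op_smul (b : B) (φ : dual M) (x : M) : (op b • φ) x = φ (b • x) := rfl
theorem dual_sum {ι : Type*} (s : Finset ι) (φ : ι → dual M) (x : M) :
    (∑ i ∈ s, φ i) x = ∑ i ∈ s, φ i x :=
  map_sum (AddMonoidHom.mk' (fun φ : dual M => φ x) (fun _ _ => rfl)) φ s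
end

/-- A finite dual basis `{e_i, e_i*}` of the right module `M_A`:
`x = ∑ e_i e_i*(x)` for all `x`. -/
structure DualBasis (M : Bimodule B A) where
  n : ℕ
  e : Fin n → M
  e' : Fin n → dual M
  sum_eq : ∀ x, ∑ i, op (e' i x) • e i = x

theorem isRightFGP_iff (M : Bimodule B A) : IsRightFGP M ↔ Nonempty (DualBasis M) := by
  rw [IsRightFGP, finite_projective_iff]
  constructor
  · rintro ⟨n, e, e', h⟩
    exact ⟨⟨n, e, fun i => ((opLinearEquiv Aᵐᵒᵖ).symm.toLinearMap.comp (e' i) : M →ₗ[Aᵐᵒᵖ] A), h⟩⟩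
  · rintro ⟨n, e, e', h⟩
    exact ⟨n, e, fun i => (opLinearEquiv Aᵐᵒᵖ).toLinearMap.comp (e' i : M →ₗ[Aᵐᵒᵖ] A), h⟩

theorem isRightFGP_regular (A : Bim.{u} k) : IsRightFGP (regular A) :=
  (isRightFGP_iff _).2 ⟨⟨1, fun _ => toRegular 1, fun _ => (LinearMap.id : A →ₗ[Aᵐᵒᵖ] A),
    fun x => (Fin.sum_univ_one _).trans (one_mul (ofRegular x))⟩⟩

theorem isLeftFGP_regular (A : Bim.{u} k) : IsLeftFGP (regular A) :=
  (finite_projective_iff _ _).2 ⟨1, fun _ => toRegular 1, fun _ => (LinearMap.id : A →ₗ[A] A),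
    fun x => (Fin.sum_univ_one _).trans (mul_one (ofRegular x))⟩

theorem IsRightFGP.tensor {M : Bimodule C B} {N : Bimodule B A} (hM : IsRightFGP M)
    (hN : IsRightFGP N) : IsRightFGP (M.tensor N) := by
  obtain ⟨⟨m, e, e', he⟩⟩ := (isRightFGP_iff M).1 hM
  obtain ⟨⟨n, f, f', hf⟩⟩ := (isRightFGP_iff N).1 hN
  let φ (i : Fin m) (j : Fin n) : M.tensor N →+ A := Bal.lift (fun x y => f' j (e' i x • y))
    (fun x x' y => by rw [map_add, add_smul, map_add]) (fun x y y' => by rw [smul_add, map_add])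
    (fun x b y => by rw [dual_map_op_smul, mul_smul])
  have hφ (i j x y) : φ i j (tmul x y) = f' j (e' i x • y) := Bal.lift_tmul ..
  have hlin (i j) (a : Aᵐᵒᵖ) (t : M.tensor N) : φ i j (a • t) = a • φ i j t := by
    induction t using tensor_induction with
    | tmul x y =>
      change φ i j (tmul x (op a.unop • y)) = _
      rw [hφ, hφ, smul_comm, dual_map_op_smul]; rfl
    | add x y hx hy => rw [smul_add, map_add, map_add, smul_add, hx, hy]
  refine (finite_projective_iff _ _).2 ?_
  let eq := finProdFinEquiv (m := m) (n := n)
  refine ⟨m * n, fun p => tmul (e (eq.symm p).1) (f (eq.symm p).2), fun p =>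
    (opLinearEquiv Aᵐᵒᵖ : A ≃ₗ[Aᵐᵒᵖ] Aᵐᵒᵖ).toLinearMap.comp
      ({ φ (eq.symm p).1 (eq.symm p).2 with map_smul' := hlin _ _ } : M.tensor N →ₗ[Aᵐᵒᵖ] A), fun t => ?_⟩
  rw [← Equiv.sum_comp eq, Fintype.sum_prod_type]
  simp only [Equiv.symm_apply_apply]
  change ∑ i, ∑ j, op (φ i j t) • tmul (e i) (f j) = t
  induction t using tensor_induction with
  | tmul x y =>
    have h1 (i : Fin m) : ∑ j, op (φ i j (tmul x y)) • tmul (e i) (f j) =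
        tmul (op (e' i x) • e i) y := by
      simp only [hφ, op_smul_tmul]
      rw [← tmul_sum, hf, balanced]
    simp only [h1]
    rw [← sum_tmul, he]
  | add x y hx hy =>
    simp only [map_add, MulOpposite.op_add, add_smul, Finset.sum_add_distrib, hx, hy]

theorem IsLeftFGP.tensor {M : Bimodule A B} {N : Bimodule B C} (hM : IsLeftFGP M)
    (hN : IsLeftFGP N) : IsLeftFGP (M.tensor N) := by
  obtain ⟨m, e, e', he⟩ := (finite_projective_iff _ _).1 hM
  obtain ⟨n, f, f', hf⟩ := (finite_projective_iff _ _).1 hN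
  let φ (i : Fin m) (j : Fin n) : M.tensor N →+ A := Bal.lift (fun x y => e' i (op (f' j y) • x))
    (fun x x' y => by rw [smul_add, map_add])
    (fun x y y' => by rw [map_add, MulOpposite.op_add, add_smul, map_add])
    (fun x b y => by
      rw [LinearMap.map_smul (f' j), smul_eq_mul, op_mul, mul_smul])
  have hφ (i j x y) : φ i j (tmul x y) = e' i (op (f' j y) • x) := Bal.lift_tmul ..
  have hlin (i j) (a : A) (t : M.tensor N) : φ i j (a • t) = a • φ i j t := by
    induction t using tensor_induction with
    | tmul x y => rw [smul_tmul, hφ, hφ, ← smul_comm, map_smul]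
    | add x y hx hy => rw [smul_add, map_add, map_add, smul_add, hx, hy]
  refine (finite_projective_iff _ _).2 ?_
  let eq := finProdFinEquiv (m := m) (n := n)
  refine ⟨m * n, fun p => tmul (e (eq.symm p).1) (f (eq.symm p).2), fun p =>
      { φ (eq.symm p).1 (eq.symm p).2 with map_smul' := hlin _ _ }, fun t => ?_⟩
  rw [← Equiv.sum_comp eq, Fintype.sum_prod_type]
  simp only [Equiv.symm_apply_apply]
  change ∑ i, ∑ j, φ i j t • tmul (e i) (f j) = t
  rw [Finset.sum_comm]
  induction t using tensor_induction with
  | tmul x y =>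
    have h1 (j : Fin n) : ∑ i, φ i j (tmul x y) • tmul (e i) (f j) = tmul x (f' j y • f j) := by
      simp only [hφ, smul_tmul]
      rw [← sum_tmul, he, balanced]
    simp only [h1]
    rw [← tmul_sum, hf]
  | add x y hx hy =>
    simp only [map_add, add_smul, Finset.sum_add_distrib, hx, hy]

/-- For `φ ∈ M*`, the map `φ ⊗_A N : M ⊗_A N → A ⊗_A N ≅ N`, `m ⊗ c ↦ φ(m) c`. -/
def contract {M : Bimodule B A} {N : Bimodule A C} (φ : dual M) : M.tensor N →+ N :=
  Bal.lift (fun m c => φ m • c) (fun m m' c => by rw [map_add, add_smul])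
    (fun m c c' => smul_add _ _ _) (fun m a c => by rw [dual_map_op_smul, mul_smul])

section
variable {M : Bimodule B A} {N : Bimodule A C}
theorem contract_tmul (φ : dual M) (m : M) (c : N) : contract φ (tmul m c) = φ m • c :=
  Bal.lift_tmul ..

theorem contract_add (φ ψ : dual M) (t : M.tensor N) :
    contract (φ + ψ) t = contract φ t + contract ψ t := by
  induction t using tensor_induction with
  | tmul m c => simp only [contract_tmul, dual_add, add_smul]
  | add x y hx hy => simp only [map_add, hx, hy]; abel

theorem contract_smul (a : A) (φ : dual M) (t : M.tensor N) :
    contract (a • φ) t = a • contract φ t := by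
  induction t using tensor_induction with
  | tmul m c => simp only [contract_tmul, dual_smul, mul_smul]
  | add x y hx hy => simp only [map_add, smul_add, hx, hy]

theorem contract_op_smul (b : B) (φ : dual M) (t : M.tensor N) :
    contract (op b • φ) t = contract φ (b • t) := by
  induction t using tensor_induction with
  | tmul m c => simp only [smul_tmul, contract_tmul, dual_op_smul]
  | add x y hx hy => simp only [map_add, smul_add, hx, hy]

theorem contract_map_op_smul (φ : dual M) (c : C) (t : M.tensor N) :
    contract φ (op c • t) = op c • contract φ t := by
  induction t using tensor_induction with
  | tmul m n => simp only [op_smul_tmul, contract_tmul, smul_comm]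
  | add x y hx hy => simp only [map_add, smul_add, hx, hy]
end

theorem DualBasis.sum_dual {M : Bimodule B A} (β : DualBasis M) (φ : dual M) :
    ∑ i, φ (β.e i) • β.e' i = φ :=
  dual_ext fun x => by
    conv_rhs => rw [← β.sum_eq x, map_sum]
    simp only [dual_sum, dual_smul, dual_map_op_smul]

theorem DualBasis.sum_op_smul {M : Bimodule B A} (β : DualBasis M) {N : Bimodule C A} (g : M → N)
    (hadd : ∀ x y, g (x + y) = g x + g y) (hg : ∀ (a : A) x, g (op a • x) = op a • g x) (b : B) :
    ∑ i, tmul (g (b • β.e i)) (β.e' i) = ∑ i, tmul (g (β.e i)) (op b • β.e' i) := by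
  let G : M →+ N := AddMonoidHom.mk' g hadd
  have h1 (i) : tmul (g (β.e i)) (op b • β.e' i) =
      ∑ j, tmul (g (op (β.e' i (b • β.e j)) • β.e i)) (β.e' j) := by
    conv_lhs => rw [← β.sum_dual (op b • β.e' i), tmul_sum]
    simp only [dual_op_smul, hg, balanced]
  simp only [h1]
  rw [Finset.sum_comm]
  refine Finset.sum_congr rfl fun j _ => ?_
  rw [← sum_tmul]
  congr 1
  have h2 := map_sum G (fun i => op (β.e' i (b • β.e j)) • β.e i) Finset.univ
  rw [β.sum_eq] at h2
  exact h2

/-- For `s : D ⊗_B M ⟶ M ⊗_A E`, the map `s_* : M* ⊗_B D ⟶ E ⊗_A M*`,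
`φ ⊗ d ↦ ∑ ((φ ⊗ E) ∘ s)(d ⊗ e_i) ⊗ e_i*`. -/
def lowerStar {M : Bimodule B A} (β : DualBasis M) {D : Bimodule B B} {E : Bimodule A A}
    (s : D.tensor M ⟶ M.tensor E) : (dual M).tensor D ⟶ E.tensor (dual M) :=
  lift (fun φ d => ∑ i, tmul (contract φ (s (tmul d (β.e i)))) (β.e' i))
    (fun φ φ' d => by simp only [contract_add, add_tmul, Finset.sum_add_distrib])
    (fun φ d d' => by simp only [add_tmul, map_add, Finset.sum_add_distrib])
    (fun φ b d => by simp only [contract_op_smul, ← hom_smul, smul_tmul])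
    (fun a φ d => by simp only [contract_smul, ← smul_tmul, Finset.smul_sum])
    (fun φ d b => by
      simp only [Finset.smul_sum, op_smul_tmul, balanced]
      exact β.sum_op_smul (fun x => contract φ (s (tmul d x)))
        (fun x y => by rw [tmul_add, map_add, map_add])
        (fun a x => by rw [← op_smul_tmul, hom_op_smul, contract_map_op_smul]) b)

/-- For `a : D ⊗_B M ⟶ M'`, the map `a_* : M'* ⊗_B D ⟶ M*`, `φ ⊗ d ↦ ∑ φ(a(d ⊗ e_i)) e_i*`. -/
def lowerStar₂ {M M' : Bimodule B A} (β : DualBasis M) {D : Bimodule B B}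
    (a : D.tensor M ⟶ M') : (dual M').tensor D ⟶ dual M :=
  lift (fun φ d => ∑ i, φ (a (tmul d (β.e i))) • β.e' i)
    (fun φ φ' d => by simp only [dual_add, add_smul, Finset.sum_add_distrib])
    (fun φ d d' => by simp only [add_tmul, map_add, add_smul, Finset.sum_add_distrib])
    (fun φ b d => by simp only [dual_op_smul, ← hom_smul, smul_tmul])
    (fun a φ d => by simp only [dual_smul, mul_smul, Finset.smul_sum])
    (fun φ d b => dual_ext fun x => by
      have h (d : D) (y : M) : (∑ i, φ (a (tmul d (β.e i))) • β.e' i) y = φ (a (tmul d y)) := by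
        conv_rhs => rw [← β.sum_eq y, tmul_sum, map_sum, map_sum]
        simp only [dual_sum, dual_smul, ← op_smul_tmul, hom_op_smul, dual_map_op_smul]
      rw [dual_op_smul, h, h, balanced])
end Bimodule
end Bim

/-! ### Conjugates, locally full sub-bicategories, biequivalences -/

/-- The conjugate of a bicategory: 2-cells are reversed. -/
structure Conj (B : Type u) where
  as : B

namespace Conj
variable {B : Type u} [Bicategory.{w, v} B]

instance : CategoryStruct (Conj B) where
  Hom a b := (a.as ⟶ b.as)ᵒᵖ
  id a := Opposite.op (𝟙 a.as)
  comp f g := Opposite.op (Opposite.unop f ≫ Opposite.unop g)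

instance homCategory (a b : Conj B) : Category (a ⟶ b) :=
  inferInstanceAs (Category (a.as ⟶ b.as)ᵒᵖ)

variable {a b c d e : Conj B}

/-- The underlying 1-cell of `B`. -/
def un (f : a ⟶ b) : a.as ⟶ b.as := Opposite.unop f

/-- The underlying 2-cell of `B`, in the opposite direction. -/
def un₂ {f g : a ⟶ b} (η : f ⟶ g) : un g ⟶ un f :=
  Quiver.Hom.unop (V := a.as ⟶ b.as) (X := f) (Y := g) η

/-- The 2-cell of the conjugate given by a 2-cell of `B` in the opposite direction. -/
def mk₂ {f g : a ⟶ b} (η : un g ⟶ un f) : f ⟶ g := Quiver.Hom.op η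

/-- The invertible 2-cell of the conjugate given by an invertible 2-cell of `B`. -/
def iso₂ {f g : a ⟶ b} (η : un f ≅ un g) : f ≅ g where
  hom := mk₂ η.inv
  inv := mk₂ η.hom
  hom_inv_id := congrArg mk₂ η.hom_inv_id
  inv_hom_id := congrArg mk₂ η.inv_hom_id

theorem hom_ext {f g : a ⟶ b} {η θ : f ⟶ g} (h : un₂ η = un₂ θ) : η = θ :=
  congrArg (fun ζ => mk₂ ζ) h

instance : Bicategory (Conj B) where
  homCategory := homCategory
  whiskerLeft f _ _ η := mk₂ (un f ◁ un₂ η)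
  whiskerRight η h := mk₂ (un₂ η ▷ un h)
  associator f g h := iso₂ (α_ (un f) (un g) (un h))
  leftUnitor f := iso₂ (λ_ (un f))
  rightUnitor f := iso₂ (ρ_ (un f))
  whiskerLeft_id f g := hom_ext (whiskerLeft_id (un f) (un g))
  whiskerLeft_comp f _ _ _ η θ := hom_ext (whiskerLeft_comp (un f) (un₂ θ) (un₂ η))
  id_whiskerLeft η := hom_ext <| (id_whiskerLeft (un₂ η)).trans (Category.assoc _ _ _).symm
  comp_whiskerLeft f g _ _ η := hom_ext <|
    (comp_whiskerLeft (un f) (un g) (un₂ η)).trans (Category.assoc _ _ _).symm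
  id_whiskerRight f g := hom_ext (id_whiskerRight (un f) (un g))
  comp_whiskerRight η θ i := hom_ext (comp_whiskerRight (un₂ θ) (un₂ η) (un i))
  whiskerRight_id η := hom_ext <|
    (whiskerRight_id (un₂ η)).trans (Category.assoc _ _ _).symm
  whiskerRight_comp η g h := hom_ext <|
    (whiskerRight_comp (un₂ η) (un g) (un h)).trans (Category.assoc _ _ _).symm
  whisker_assoc f _ _ η h := hom_ext <|
    (whisker_assoc (un f) (un₂ η) (un h)).trans (Category.assoc _ _ _).symm
  whisker_exchange η θ := hom_ext (whisker_exchange (un₂ η) (un₂ θ)).symm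
  pentagon f g h i := hom_ext <| (Category.assoc _ _ _).trans
    (pentagon_inv (un f) (un g) (un h) (un i))
  triangle f g := hom_ext (triangle_assoc_comp_left_inv (un f) (un g))

end Conj

/-- Data for a bicategory with objects indexed by `ι` (the object `i` standing for `obj i`), with
1-cells the 1-cells of `B` satisfying `P`, and with all 2-cells of `B` between them. -/
structure SubData (ι : Type*) (B : Type u) [Bicategory.{w, v} B] where
  obj : ι → B
  P : ∀ i j, ObjectProperty (obj i ⟶ obj j)
  id_mem : ∀ i, P i i (𝟙 (obj i))
  comp_mem : ∀ {i j l} (f : obj i ⟶ obj j) (g : obj j ⟶ obj l), P i j f → P j l g → P i l (f ≫ g)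

/-- The bicategory given by the data `S`. -/
structure SubData.Obj {ι : Type*} {B : Type u} [Bicategory.{w, v} B] (S : SubData ι B) where
  as : ι

namespace SubData
variable {ι : Type*} {B : Type u} [Bicategory.{w, v} B] (S : SubData ι B)

instance : CategoryStruct S.Obj where
  Hom i j := (S.P i.as j.as).FullSubcategory
  id i := ⟨𝟙 (S.obj i.as), S.id_mem i.as⟩
  comp f g := ⟨f.obj ≫ g.obj, S.comp_mem _ _ f.property g.property⟩

instance homCategory (i j : S.Obj) : Category (i ⟶ j) :=
  inferInstanceAs (Category (S.P i.as j.as).FullSubcategory)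

instance : Bicategory S.Obj where
  homCategory := homCategory S
  whiskerLeft f _ _ η := ObjectProperty.homMk (f.obj ◁ η.hom)
  whiskerRight η h := ObjectProperty.homMk (η.hom ▷ h.obj)
  associator f g h := ObjectProperty.isoMk _ (α_ f.obj g.obj h.obj)
  leftUnitor f := ObjectProperty.isoMk _ (λ_ f.obj)
  rightUnitor f := ObjectProperty.isoMk _ (ρ_ f.obj)
  whiskerLeft_id f g := ObjectProperty.hom_ext _ (whiskerLeft_id f.obj g.obj)
  whiskerLeft_comp f _ _ _ η θ := ObjectProperty.hom_ext _ (whiskerLeft_comp f.obj η.hom θ.hom)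
  id_whiskerLeft η := ObjectProperty.hom_ext _ (id_whiskerLeft η.hom)
  comp_whiskerLeft f g _ _ η := ObjectProperty.hom_ext _ (comp_whiskerLeft f.obj g.obj η.hom)
  id_whiskerRight f g := ObjectProperty.hom_ext _ (id_whiskerRight f.obj g.obj)
  comp_whiskerRight η θ i := ObjectProperty.hom_ext _ (comp_whiskerRight η.hom θ.hom i.obj)
  whiskerRight_id η := ObjectProperty.hom_ext _ (whiskerRight_id η.hom)
  whiskerRight_comp η g h := ObjectProperty.hom_ext _ (whiskerRight_comp η.hom g.obj h.obj)
  whisker_assoc f _ _ η h := ObjectProperty.hom_ext _ (whisker_assoc f.obj η.hom h.obj)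
  whisker_exchange η θ := ObjectProperty.hom_ext _ (whisker_exchange η.hom θ.hom)
  pentagon f g h i := ObjectProperty.hom_ext _ (pentagon f.obj g.obj h.obj i.obj)
  triangle f g := ObjectProperty.hom_ext _ (triangle f.obj g.obj)

end SubData

/-- A pseudofunctor is a biequivalence if it is an equivalence on all hom-categories and every
object of the target is (internally) equivalent to an object in its image. -/
structure IsBiequivalence {B C : Type*} [Bicategory B] [Bicategory C] (F : B ⥤ᵖ C) : Prop where
  isEquivalence : ∀ a b : B, (F.mapFunctor a b).IsEquivalence
  exists_equivalence : ∀ c : C, ∃ b : B, Nonempty (Bicategory.Equivalence (F.obj b) c)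

open _root_.Bicategory.Opposite in
/-- A comonad in `B`, seen as a comonad in `Bᵒᵖ`. -/
@[simps base cell]
def REM.op {B : Type u} [Bicategory.{w, v} B] (X : REM B) : REM Bᵒᵖ where
  base := Opposite.op X.base
  cell := X.cell.op
  comonad :=
    { counit := op2 X.counit
      comul := op2 X.comul
      counit_comul := congrArg op2 (Comonad.comul_counit X.cell)
      comul_counit := congrArg op2 (Comonad.counit_comul X.cell)
      comul_assoc := by
        have h := congrArg op2 (Comonad.comul_assoc_flip X.cell)
        exact h }

/-! ### fREM and fLEM -/
section
variable (k : Type v) [CommRing k]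

/-- `fREM(Bim)`: the objects are the corings `(C : A)`, the 1-cells from `(C : A)` to `(D : B)` are
the 1-cells `(Σ, s)` of `REM(Bim)` with `Σ_A` finitely generated and projective, and the 2-cells are
those of `REM(Bim)`. -/
abbrev fREMData : SubData (REM (Bim.{u} k)) (REM (Bim.{u} k)) where
  obj X := X
  P _ _ := fun S => Bim.Bimodule.IsRightFGP S.f
  id_mem X := Bim.Bimodule.isRightFGP_regular X.base
  comp_mem _ _ hS hT := Bim.Bimodule.IsRightFGP.tensor hT hS

/-- `fLEM(Bim)`: the objects are the corings `(C : A)`. The bicategory `LEM(Bim) = EM(Bim^co)^coop`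
is `REM(Bimᵒᵖ)`; a 1-cell from `(C : A)` to `(D : B)` is an `(A, B)`-bimodule `Ξ` with a
compatible map `Ξ ⊗_B D ⟶ C ⊗_A Ξ`, a 2-cell a compatible map `Ξ ⊗_B D ⟶ Ξ'`. The 1-cells of
`fLEM(Bim)` are those with `_AΞ` finitely generated and projective. -/
abbrev fLEMData : SubData (REM (Bim.{u} k)) (REM (Bim.{u} k)ᵒᵖ) where
  obj X := X.op
  P _ _ := fun S => Bim.Bimodule.IsLeftFGP S.f.unop
  id_mem X := Bim.Bimodule.isLeftFGP_regular X.base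
  comp_mem _ _ hS hT := Bim.Bimodule.IsLeftFGP.tensor hS hT

/-- The bicategory `fREM(Bim)`. -/
abbrev fREM := (fREMData.{u} k).Obj

/-- The bicategory `fLEM(Bim)`. -/
abbrev fLEM := (fLEMData.{u} k).Obj

variable {k}
variable {X Y : fREM.{u} k}

open Bim.Bimodule

/-- A chosen finite dual basis of `Σ_A`, for a 1-cell `(Σ, s)` of `fREM(Bim)`. -/
noncomputable def fREM.dualBasis (S : X ⟶ Y) : DualBasis S.obj.f :=
  ((isRightFGP_iff _).1 S.property).some

/-- The `(A, B)`-bimodule `Σ*`, as a 1-cell from `A` to `B` of `Bimᵒᵖ`. -/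
def starBimodule (S : X ⟶ Y) : X.as.op.base ⟶ Y.as.op.base :=
  Quiver.Hom.op (X := Y.as.base) (Y := X.as.base) (dual S.obj.f)

/-- The map `s_* : Σ* ⊗_B D ⟶ C ⊗_A Σ*`. -/
noncomputable def starMap (S : X ⟶ Y) :
    starBimodule S ≫ Y.as.op.cell ⟶ X.as.op.cell ≫ starBimodule S :=
  .op2' (lowerStar (fREM.dualBasis S) S.obj.s)

/-- The map `a_* : Σ'* ⊗_B D ⟶ Σ*`, for a 2-cell `a : D ⊗_B Σ ⟶ Σ'` from `(Σ, s)` to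
`(Σ', s')`. -/
noncomputable def starMap₂ {S T : X ⟶ Y} (a : S ⟶ T) :
    starBimodule T ≫ Y.as.op.cell ⟶ starBimodule S :=
  .op2' (lowerStar₂ (fREM.dualBasis S) a.hom.hom)

variable (k) in
/-- The assignments `(Σ, s) ↦ (Σ*, s_*)` and `a ↦ a_*` do not depend on the choice of dual bases and
define contravariant functors from the hom-categories of `fREM(Bim)` to those of `fLEM(Bim)`. -/
structure DualityLaws : Prop where
  /-- `s_*` does not depend on the dual basis. -/
  lowerStar_eq : ∀ {A B : Bim.{u} k} {M : Bim.Bimodule B A} (β β' : DualBasis M)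
    {D : Bim.Bimodule B B} {E : Bim.Bimodule A A} (s : D.tensor M ⟶ M.tensor E),
    lowerStar β s = lowerStar β' s
  /-- `a_*` does not depend on the dual basis. -/
  lowerStar₂_eq : ∀ {A B : Bim.{u} k} {M M' : Bim.Bimodule B A} (β β' : DualBasis M)
    {D : Bim.Bimodule B B} (a : D.tensor M ⟶ M'), lowerStar₂ β a = lowerStar₂ β' a
  /-- `_A(Σ*)` is finitely generated and projective. -/
  isLeftFGP : ∀ {X Y : fREM.{u} k} (S : X ⟶ Y), IsLeftFGP (dual S.obj.f)
  /-- `(Σ*, s_*)` is a 1-cell of `LEM(Bim)`. -/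
  isCell : ∀ {X Y : fREM.{u} k} (S : X ⟶ Y),
    REM.IsCell X.as.op Y.as.op (starBimodule S) (starMap S)
  /-- `a_*` is a 2-cell of `LEM(Bim)` from `(Σ'*, s'_*)` to `(Σ*, s_*)`. -/
  isCell₂ : ∀ {X Y : fREM.{u} k} {S T : X ⟶ Y} (a : S ⟶ T),
    REM.IsCell₂ ⟨starBimodule T, starMap T, isCell T⟩ ⟨starBimodule S, starMap S, isCell S⟩
      (starMap₂ a)
  /-- `(-)_*` sends the identity 2-cell of `(Σ, s)` to the identity 2-cell of `(Σ*, s_*)`. -/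
  map_id : ∀ {X Y : fREM.{u} k} (S : X ⟶ Y),
    starMap₂ (𝟙 S) = starBimodule S ◁ Y.as.op.counit ≫ (ρ_ (starBimodule S)).hom
  /-- `(-)_*` reverses vertical composition: `(b ∘ a)_* = a_* ∘ (b_* ⊗ D) ∘ (Σ''* ⊗ Δ)`. -/
  map_comp : ∀ {X Y : fREM.{u} k} {S T U : X ⟶ Y} (a : S ⟶ T) (b : T ⟶ U),
    starMap₂ (a ≫ b) = starBimodule U ◁ Y.as.op.comul ≫
      (α_ (starBimodule U) Y.as.op.cell Y.as.op.cell).inv ≫ starMap₂ b ▷ Y.as.op.cell ≫ starMap₂ a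

/-- The 1-cell `(Σ*, s_*)` of `LEM(Bim)`. -/
noncomputable def starCell (h : DualityLaws.{u} k) (S : X ⟶ Y) : X.as.op ⟶ Y.as.op :=
  REM.Cell.mk (starBimodule S) (starMap S) (h.isCell S)

/-- The functor `𝒟` from the hom-category of `fREM(Bim)` from `(C : A)` to `(D : B)` to the opposite
of the hom-category of `fLEM(Bim)` from `(C : A)` to `(D : B)`, that is, to the hom-category of
`fLEM(Bim)^co`: `(Σ, s) ↦ (Σ*, s_*)` and `a ↦ a_*`. -/
noncomputable def dualityFunctor (h : DualityLaws.{u} k) (X Y : fREM.{u} k) :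
    (X ⟶ Y) ⥤ ((⟨⟨X.as⟩⟩ : Conj (fLEM.{u} k)) ⟶ ⟨⟨Y.as⟩⟩) where
  obj S := Opposite.op ⟨starCell h S, h.isLeftFGP S⟩
  map a := Conj.mk₂ (ObjectProperty.homMk (REM.Cell₂.mk (starMap₂ a) (h.isCell₂ a)))
  map_id S := Conj.hom_ext (ObjectProperty.hom_ext _ (REM.hom_ext
    ((h.map_id S).trans (REM.id_hom (starCell h S)).symm)))
  map_comp a b := Conj.hom_ext (ObjectProperty.hom_ext _ (REM.hom_ext (h.map_comp a b)))
end

/-!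
The statement is a calculus of mates. If `M_A` is finitely generated and projective, tensoring with
`M` and with `M*` are adjoint, so that maps `s : D ⊗ M ⟶ M' ⊗ E` correspond bijectively to maps
`t : M'* ⊗ D ⟶ E ⊗ M*`: they are mates if they give the same pairing `M'* ⊗ D ⊗ M ⟶ E`
(`IsMate`, and `IsMate₂` in the absence of `E`). With a dual basis, elements of `M ⊗ Z` are
separated by the contractions with `φ ∈ M*`, and elements of `Y ⊗ M*` by the evaluations at
`x ∈ M`; hence mates exist and determine each other (`exists_isMate`, `IsMate.eq_iff`). The maps
`s_*` and `a_*` are the mates of `s` and `a`, whatever the dual basis.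

Mates are compatible with pasting (`IsMate.paste` and its variants). Therefore each side of an axiom
of a cell of `REM(Bim)` is the mate of one side of the same axiom in `LEM(Bim)`, and a map is a
cell exactly if its mate is one (`IsMate.isCell_iff`, `IsMate₂.isCell₂_iff`). This gives the
functors `𝒟` and their full faithfulness. They are essentially surjective because a bimodule `Ξ`
with `_AΞ` finitely generated and projective is the right dual of its left dual
(`IsLeftFGP.leftDual`), and 1-cell structures can be transported along `Ξ ≅ (*Ξ)*`.

The structure isomorphisms of the pseudofunctor are the canonical maps `A ⟶ A*` and
`N* ⊗ M* ⟶ (M ⊗ N)*`, which are isomorphisms if `M` has a dual basis. They commute with the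
structure maps, so that they are 2-cells of the form `ε ⊗ u` (`REM.IsStrict`). Composites and
whiskerings of such 2-cells are computed on the bimodule maps `u`, and the coherence laws become
identities between elements of duals of tensor products. The pseudofunctor is the identity on
objects, so it is a biequivalence as soon as it is an equivalence on hom-categories.
-/

namespace Bim.Bimodule
variable {k : Type v} [CommRing k] {A B C A' B' A'' B'' : Bim.{u} k}

/-! ### Pairings and mates of bimodule maps -/

/-- For `x ∈ M`, the map `Y ⊗_A M* → Y`, `y ⊗ φ ↦ y φ(x)`. -/
def evalAt {M : Bimodule B A} {Y : Bimodule C A} (x : M) : Y.tensor (dual M) →+ Y :=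
  Bal.lift (fun y φ => op (φ x) • y) (fun _ _ _ => smul_add _ _ _)
    (fun y φ ψ => by rw [dual_add, MulOpposite.op_add, add_smul])
    (fun y a φ => by rw [dual_smul, op_mul, mul_smul])

section
variable {M : Bimodule B A} {Y : Bimodule C A}

theorem evalAt_tmul (x : M) (y : Y) (φ : dual M) : evalAt x (tmul y φ) = op (φ x) • y :=
  Bal.lift_tmul ..

theorem evalAt_add (x x' : M) (t : Y.tensor (dual M)) :
    evalAt (x + x') t = evalAt x t + evalAt x' t := by
  induction t using tensor_induction with
  | tmul y φ => simp only [evalAt_tmul, map_add, MulOpposite.op_add, add_smul]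
  | add t t' ht ht' => simp only [map_add, ht, ht']; abel

theorem evalAt_op_smul (x : M) (a : A) (t : Y.tensor (dual M)) :
    evalAt (op a • x) t = op a • evalAt x t := by
  induction t using tensor_induction with
  | tmul y φ => simp only [evalAt_tmul, dual_map_op_smul, op_mul, mul_smul]
  | add t t' ht ht' => simp only [map_add, smul_add, ht, ht']

theorem evalAt_map_op_smul (x : M) (b : B) (t : Y.tensor (dual M)) :
    evalAt x (op b • t) = evalAt (b • x) t := by
  induction t using tensor_induction with
  | tmul y φ => simp only [op_smul_tmul, evalAt_tmul, dual_op_smul]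
  | add t t' ht ht' => simp only [map_add, smul_add, ht, ht']

theorem evalAt_map {Y' : Bimodule C A} (f : Y ⟶ Y') (x : M) (t : Y.tensor (dual M)) :
    evalAt x (map f (𝟙 _) t) = f (evalAt x t) := by
  induction t using tensor_induction with
  | tmul y φ => simp only [map_tmul, id_apply, evalAt_tmul, hom_op_smul]
  | add t t' ht ht' => simp only [map_add, ht, ht']

theorem contract_map {Z Z' : Bimodule A C} (f : Z ⟶ Z') (φ : dual M) (t : M.tensor Z) :
    contract φ (map (𝟙 _) f t) = f (contract φ t) := by
  induction t using tensor_induction with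
  | tmul m z => simp only [map_tmul, id_apply, contract_tmul, hom_smul]
  | add t t' ht ht' => simp only [map_add, ht, ht']

theorem DualBasis.sum_evalAt (β : DualBasis M) (t : Y.tensor (dual M)) :
    ∑ i, tmul (evalAt (β.e i) t) (β.e' i) = t := by
  induction t using tensor_induction with
  | tmul y φ => simp only [evalAt_tmul, balanced]; rw [← tmul_sum, β.sum_dual]
  | add t t' ht ht' => simp only [map_add, add_tmul, Finset.sum_add_distrib, ht, ht']

theorem DualBasis.sum_contract (β : DualBasis M) {Z : Bimodule A C} (t : M.tensor Z) :
    ∑ i, tmul (β.e i) (contract (β.e' i) t) = t := by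
  induction t using tensor_induction with
  | tmul m z => simp only [contract_tmul, ← balanced]; rw [← sum_tmul, β.sum_eq]
  | add t t' ht ht' => simp only [map_add, tmul_add, Finset.sum_add_distrib, ht, ht']

/-- If `M_A` is finitely generated and projective, elements of `Y ⊗_A M*` are separated by the
evaluations at the elements of `M`. -/
theorem DualBasis.evalAt_ext (β : DualBasis M) {t t' : Y.tensor (dual M)}
    (h : ∀ x : M, evalAt x t = evalAt x t') : t = t' := by
  rw [← β.sum_evalAt t, ← β.sum_evalAt t']; simp only [h]

/-- If `M_A` is finitely generated and projective, elements of `M ⊗_A Z` are separated by the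
contractions with the elements of `M*`. -/
theorem DualBasis.contract_ext (β : DualBasis M) {Z : Bimodule A C} {t t' : M.tensor Z}
    (h : ∀ φ : dual M, contract φ t = contract φ t') : t = t' := by
  rw [← β.sum_contract t, ← β.sum_contract t']; simp only [h]

theorem DualBasis.ext_apply (β : DualBasis M) {x y : M} (h : ∀ φ : dual M, φ x = φ y) : x = y := by
  rw [← β.sum_eq x, ← β.sum_eq y]; simp only [h]

end

/-- The maps `s : D ⊗_B M ⟶ M' ⊗_{A'} E` and `t : M'* ⊗_{B'} D ⟶ E ⊗_A M*` correspond to each other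
under the adjunctions between tensoring with `M`, `M'` and with their duals: both yield the same
pairing `M'* ⊗ D ⊗ M ⟶ E`. -/
def IsMate {M : Bimodule B A} {M' : Bimodule B' A'} {D : Bimodule B' B} {E : Bimodule A' A}
    (s : D.tensor M ⟶ M'.tensor E) (t : (dual M').tensor D ⟶ E.tensor (dual M)) : Prop :=
  ∀ φ d x, evalAt x (t (tmul φ d)) = contract φ (s (tmul d x))

/-- The relation `IsMate` for a trivial `E`: the maps `a : D ⊗_B M ⟶ M'` and
`b : M'* ⊗_{B'} D ⟶ M*` yield the same pairing `M'* ⊗ D ⊗ M ⟶ A`. -/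
def IsMate₂ {M : Bimodule B A} {M' : Bimodule B' A} {D : Bimodule B' B}
    (a : D.tensor M ⟶ M') (b : (dual M').tensor D ⟶ dual M) : Prop :=
  ∀ φ d x, b (tmul φ d) x = φ (a (tmul d x))

section
variable {M : Bimodule B A} {D : Bimodule B B}

theorem lowerStar_tmul (β : DualBasis M) {E : Bimodule A A} (s : D.tensor M ⟶ M.tensor E)
    (φ : dual M) (d : D) : lowerStar β s (tmul φ d) =
      ∑ i, tmul (contract φ (s (tmul d (β.e i)))) (β.e' i) := lift_tmul ..

theorem lowerStar₂_tmul (β : DualBasis M) {M' : Bimodule B A} (a : D.tensor M ⟶ M')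
    (φ : dual M') (d : D) : lowerStar₂ β a (tmul φ d) =
      ∑ i, φ (a (tmul d (β.e i))) • β.e' i := lift_tmul ..

theorem isMate_lowerStar (β : DualBasis M) {E : Bimodule A A} (s : D.tensor M ⟶ M.tensor E) :
    IsMate s (lowerStar β s) := fun φ d x => by
  rw [lowerStar_tmul, map_sum]
  conv_rhs => rw [← β.sum_eq x, tmul_sum, map_sum, map_sum]
  simp only [evalAt_tmul, ← op_smul_tmul, hom_op_smul, contract_map_op_smul]

theorem isMate₂_lowerStar₂ (β : DualBasis M) {M' : Bimodule B A} (a : D.tensor M ⟶ M') :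
    IsMate₂ a (lowerStar₂ β a) := fun φ d x => by
  rw [lowerStar₂_tmul]
  conv_rhs => rw [← β.sum_eq x, tmul_sum, map_sum, map_sum]
  simp only [dual_sum, dual_smul, ← op_smul_tmul, hom_op_smul, dual_map_op_smul]

end

section
variable {M : Bimodule B A} {M' : Bimodule B' A'} {M'' : Bimodule B'' A''}
  {D : Bimodule B' B} {E : Bimodule A' A}

/-- Mates determine each other. -/
theorem IsMate.eq_iff (β : DualBasis M) (β' : DualBasis M') {s s' : D.tensor M ⟶ M'.tensor E}
    {t t' : (dual M').tensor D ⟶ E.tensor (dual M)} (h : IsMate s t) (h' : IsMate s' t') :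
    s = s' ↔ t = t' := by
  constructor <;> rintro rfl
  · exact tensor_hom_ext fun φ d => β.evalAt_ext fun x => by rw [h, h']
  · exact tensor_hom_ext fun d x => β'.contract_ext fun φ => by rw [← h, ← h']

theorem IsMate₂.eq_iff {M' : Bimodule B' A} (β' : DualBasis M') {a a' : D.tensor M ⟶ M'}
    {b b' : (dual M').tensor D ⟶ dual M} (h : IsMate₂ a b) (h' : IsMate₂ a' b') :
    a = a' ↔ b = b' := by
  constructor <;> rintro rfl
  · exact tensor_hom_ext fun φ d => dual_ext fun x => by rw [h, h']
  · exact tensor_hom_ext fun d x => β'.ext_apply fun φ => by rw [← h, ← h']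

/-- Every map `M'* ⊗ D ⟶ E ⊗ M*` is the mate of a map `D ⊗ M ⟶ M' ⊗ E`, namely of
`d ⊗ x ↦ ∑ e_i ⊗ (E ⊗ x)(t(e_i* ⊗ d))`. -/
theorem exists_isMate (β' : DualBasis M') (t : (dual M').tensor D ⟶ E.tensor (dual M)) :
    ∃ s : D.tensor M ⟶ M'.tensor E, IsMate s t := by
  have key (g : D → dual M' → E) (hadd : ∀ d φ ψ, g d (φ + ψ) = g d φ + g d ψ)
      (hsmul : ∀ d (a : A') φ, g d (a • φ) = a • g d φ) (d : D) (φ : dual M') :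
      contract φ (∑ i, tmul (β'.e i) (g d (β'.e' i))) = g d φ := by
    let G : dual M' →+ E := AddMonoidHom.mk' (g d) (hadd d)
    have hG : G (∑ i, φ (β'.e i) • β'.e' i) = ∑ i, φ (β'.e i) • G (β'.e' i) := by
      rw [map_sum]; exact Finset.sum_congr rfl fun i _ => hsmul _ _ _
    rw [β'.sum_dual] at hG
    rw [map_sum]
    simp only [contract_tmul]
    exact hG.symm
  have key' (x : M) (d : D) (φ : dual M') :
      contract φ (∑ i, tmul (β'.e i) (evalAt x (t (tmul (β'.e' i) d)))) =
        evalAt x (t (tmul φ d)) :=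
    key (fun d φ => evalAt x (t (tmul φ d))) (fun d φ ψ => by rw [add_tmul, map_add, map_add])
      (fun d a φ => by
        rw [← smul_tmul, hom_smul]
        generalize t (tmul φ d) = y
        induction y using tensor_induction with
        | tmul e ψ => simp only [smul_tmul, evalAt_tmul, smul_comm]
        | add y y' hy hy' => simp only [smul_add, map_add, hy, hy']) d φ
  refine ⟨lift (fun d x => ∑ i, tmul (β'.e i) (evalAt x (t (tmul (β'.e' i) d)))) ?_ ?_ ?_ ?_ ?_,
    fun φ d x => by rw [lift_tmul, key']⟩
  · intro d d' x; simp only [tmul_add, map_add, Finset.sum_add_distrib]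
  · intro d x x'; simp only [evalAt_add, tmul_add, Finset.sum_add_distrib]
  · intro d b x; simp only [← op_smul_tmul, hom_op_smul, evalAt_map_op_smul]
  · intro b d x
    refine β'.contract_ext fun φ => ?_
    rw [← contract_op_smul, key', key', ← balanced]
  · intro d x a; simp only [evalAt_op_smul, Finset.smul_sum, op_smul_tmul]

/-- Every map `M'* ⊗ D ⟶ M*` is the mate of a map `D ⊗ M ⟶ M'`. -/
theorem exists_isMate₂ {M' : Bimodule B' A} (β' : DualBasis M')
    (b : (dual M').tensor D ⟶ dual M) : ∃ a : D.tensor M ⟶ M', IsMate₂ a b := by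
  have key (x : M) (d : D) (φ : dual M') :
      φ (∑ i, op (b (tmul (β'.e' i) d) x) • β'.e i) = b (tmul φ d) x := by
    conv_rhs => rw [← β'.sum_dual φ, sum_tmul, map_sum]
    simp only [map_sum, dual_map_op_smul, ← smul_tmul, hom_smul, dual_sum, dual_smul]
  refine ⟨lift (fun d x => ∑ i, op (b (tmul (β'.e' i) d) x) • β'.e i) ?_ ?_ ?_ ?_ ?_,
    fun φ d x => by rw [lift_tmul, key]⟩
  · intro d d' x
    simp only [tmul_add, map_add, dual_add, MulOpposite.op_add, add_smul, Finset.sum_add_distrib]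
  · intro d x x'; simp only [map_add, MulOpposite.op_add, add_smul, Finset.sum_add_distrib]
  · intro d b' x; simp only [← op_smul_tmul, hom_op_smul, dual_op_smul]
  · intro b' d x
    refine β'.ext_apply fun φ => ?_
    rw [← dual_op_smul, key, key, ← balanced]
  · intro d x a; simp only [dual_map_op_smul, op_mul, mul_smul, Finset.smul_sum]

theorem IsMate.comp {s : D.tensor M ⟶ M'.tensor E} {t : (dual M').tensor D ⟶ E.tensor (dual M)}
    (h : IsMate s t) {E' : Bimodule A' A} (f : E ⟶ E') :
    IsMate (s ≫ map (𝟙 _) f) (t ≫ map f (𝟙 _)) := fun φ d x => by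
  rw [comp_apply, comp_apply, evalAt_map, contract_map, h]

theorem IsMate.precomp {s : D.tensor M ⟶ M'.tensor E}
    {t : (dual M').tensor D ⟶ E.tensor (dual M)} (h : IsMate s t) {D' : Bimodule B' B}
    (f : D' ⟶ D) : IsMate (map f (𝟙 _) ≫ s) (map (𝟙 _) f ≫ t) := fun φ d x => by
  simp only [comp_apply, map_tmul, id_apply, h φ (f d) x]

theorem IsMate₂.precomp {M' : Bimodule B' A} {a : D.tensor M ⟶ M'}
    {b : (dual M').tensor D ⟶ dual M} (h : IsMate₂ a b) {D' : Bimodule B' B}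
    (f : D' ⟶ D) : IsMate₂ (map f (𝟙 _) ≫ a) (map (𝟙 _) f ≫ b) := fun φ d x => by
  simp only [comp_apply, map_tmul, id_apply, h φ (f d) x]

/-- Mates remain mates when `E` is collapsed along a counit `f : E ⟶ A`. -/
theorem IsMate.counit {M' : Bimodule B' A} {E : Bimodule A A} {s : D.tensor M ⟶ M'.tensor E}
    {t : (dual M').tensor D ⟶ E.tensor (dual M)} (h : IsMate s t) (f : E ⟶ regular A) :
    IsMate₂ (s ≫ map (𝟙 _) f ≫ (tensorRegular M').hom)
      (t ≫ map f (𝟙 _) ≫ (regularTensor _).hom) := fun φ d x => by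
  have h1 (y : E.tensor (dual M)) :
      (regularTensor (dual M)).hom (map f (𝟙 _) y) x = ofRegular (f (evalAt x y)) := by
    induction y using tensor_induction with
    | tmul e ψ =>
      rw [map_tmul, regularTensor_tmul, evalAt_tmul, hom_op_smul]; rfl
    | add y y' hy hy' => simp only [map_add, dual_add, hy, hy']; rfl
  have h2 (y : M'.tensor E) :
      φ ((tensorRegular M').hom (map (𝟙 _) f y)) = ofRegular (f (contract φ y)) := by
    induction y using tensor_induction with
    | tmul e ψ =>
      rw [map_tmul, tensorRegular_tmul, contract_tmul, hom_smul, dual_map_op_smul]; rfl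
    | add y y' hy hy' => simp only [map_add, hy, hy']; rfl
  simp only [comp_apply]
  rw [h1, h2, h]

theorem isMate₂_counit {D : Bimodule B B} (f : D ⟶ regular B) :
    IsMate₂ (map f (𝟙 M) ≫ (regularTensor M).hom)
      (map (𝟙 (dual M)) f ≫ (tensorRegular _).hom) := fun φ d x => by
  simp only [comp_apply, map_tmul, regularTensor_tmul, tensorRegular_tmul, id_apply, dual_op_smul]

variable {D' : Bimodule B'' B'} {E' : Bimodule A'' A'}

/-- Mates are compatible with pasting squares along `M'`. The two composites are those on the right
hand sides of the comultiplicativity axioms of 1-cells of `REM(Bim)` and of `LEM(Bim)`. -/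
theorem IsMate.paste {s : D.tensor M ⟶ M'.tensor E} {t : (dual M').tensor D ⟶ E.tensor (dual M)}
    {s' : D'.tensor M' ⟶ M''.tensor E'} {t' : (dual M'').tensor D' ⟶ E'.tensor (dual M')}
    (h : IsMate s t) (h' : IsMate s' t') :
    IsMate ((assoc D' D M).inv ≫ map (𝟙 _) s ≫ (assoc D' M' E).hom ≫ map s' (𝟙 _) ≫
        (assoc M'' E' E).inv)
      ((assoc (dual M'') D' D).hom ≫ map t' (𝟙 _) ≫ (assoc E' (dual M') D).inv ≫ map (𝟙 _) t ≫
        (assoc E' E (dual M)).hom) := by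
  -- both sides equal the image of `s (d ⊗ x)` under `m ⊗ e ↦ (E' ⊗ m)(t' (φ ⊗ d')) ⊗ e`
  let slide (τ : E'.tensor (dual M')) : M'.tensor E →+ E'.tensor E :=
    Bal.lift (fun m e => tmul (evalAt m τ) e) (fun m m' e => by rw [evalAt_add, add_tmul])
      (fun m e e' => tmul_add _ _ _) (fun m a e => by rw [evalAt_op_smul, balanced])
  have hslide (τ m e) : slide τ (tmul m e) = tmul (evalAt m τ) e := Bal.lift_tmul ..
  have hadd (τ τ' σ) : slide (τ + τ') σ = slide τ σ + slide τ' σ := by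
    induction σ using tensor_induction with
    | tmul m e => simp only [hslide, map_add, add_tmul]
    | add y y' hy hy' => simp only [map_add, hy, hy']; abel
  have hs (e' ψ σ) : slide (tmul e' ψ) σ = tmul e' (contract ψ σ) := by
    induction σ using tensor_induction with
    | tmul m e => rw [hslide, evalAt_tmul, contract_tmul, balanced]
    | add y y' hy hy' => rw [map_add, map_add, tmul_add, hy, hy']
  intro φ d x
  induction d using tensor_induction with
  | add d d' hd hd' => simp only [tmul_add, add_tmul, map_add, hd, hd']
  | tmul d' d =>
    simp only [comp_apply, assoc_hom_tmul, assoc_inv_tmul, map_tmul, id_apply]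
    have h1 (τ : E'.tensor (dual M')) : evalAt x ((assoc E' E (dual M)).hom
        (map (𝟙 _) t ((assoc E' (dual M') D).inv (tmul τ d)))) = slide τ (s (tmul d x)) := by
      induction τ using tensor_induction with
      | add y y' hy hy' => simp only [add_tmul, map_add, hadd, hy, hy']
      | tmul e' ψ =>
        rw [assoc_inv_tmul, map_tmul, id_apply, hs, ← h]
        generalize t (tmul ψ d) = y
        induction y using tensor_induction with
        | tmul e χ => rw [assoc_hom_tmul, evalAt_tmul, evalAt_tmul, op_smul_tmul]
        | add y y' hy hy' => simp only [tmul_add, map_add, hy, hy']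
    rw [h1]
    generalize s (tmul d x) = σ
    induction σ using tensor_induction with
    | add y y' hy hy' => simp only [tmul_add, map_add, hy, hy']
    | tmul m e =>
      rw [hslide, h', assoc_hom_tmul, map_tmul, id_apply]
      generalize s' (tmul d' m) = y
      induction y using tensor_induction with
      | tmul m' e' => rw [assoc_inv_tmul, contract_tmul, contract_tmul, smul_tmul]
      | add y y' hy hy' => simp only [add_tmul, map_add, hy, hy']

/-- Pasting of `s` with a square `a` that has a trivial coring side: the left hand side of the
axiom of a 2-cell of `REM(Bim)` corresponds to the right hand side of the one of `LEM(Bim)`. -/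
theorem IsMate.paste₂ {M'' : Bimodule B'' A'} {s : D.tensor M ⟶ M'.tensor E}
    {t : (dual M').tensor D ⟶ E.tensor (dual M)}
    {a : D'.tensor M' ⟶ M''} {b : (dual M'').tensor D' ⟶ dual M'}
    (h : IsMate s t) (h' : IsMate₂ a b) :
    IsMate ((assoc D' D M).inv ≫ map (𝟙 _) s ≫ (assoc D' M' E).hom ≫ map a (𝟙 _))
      ((assoc (dual M'') D' D).hom ≫ map b (𝟙 _) ≫ t) := by
  intro φ d x
  induction d using tensor_induction with
  | add d d' hd hd' => simp only [tmul_add, add_tmul, map_add, hd, hd']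
  | tmul d' d =>
    simp only [comp_apply, assoc_hom_tmul, assoc_inv_tmul, map_tmul, id_apply]
    rw [h]
    generalize s (tmul d x) = σ
    induction σ using tensor_induction with
    | add y y' hy hy' => simp only [tmul_add, map_add, hy, hy']
    | tmul m e => rw [assoc_hom_tmul, map_tmul, id_apply, contract_tmul, contract_tmul, h']

/-- Pasting of `s'` with a square `a` that has a trivial coring side: the right hand side of the
axiom of a 2-cell of `REM(Bim)` corresponds to the left hand side of the one of `LEM(Bim)`. -/
theorem IsMate₂.paste {M' : Bimodule B' A} {E' : Bimodule A'' A} {a : D.tensor M ⟶ M'}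
    {b : (dual M').tensor D ⟶ dual M}
    {s' : D'.tensor M' ⟶ M''.tensor E'} {t' : (dual M'').tensor D' ⟶ E'.tensor (dual M')}
    (h : IsMate₂ a b) (h' : IsMate s' t') :
    IsMate ((assoc D' D M).inv ≫ map (𝟙 _) a ≫ s')
      ((assoc (dual M'') D' D).hom ≫ map t' (𝟙 _) ≫ (assoc E' (dual M') D).inv ≫
        map (𝟙 _) b) := by
  intro φ d x
  induction d using tensor_induction with
  | add d d' hd hd' => simp only [tmul_add, add_tmul, map_add, hd, hd']
  | tmul d' d =>
    simp only [comp_apply, assoc_hom_tmul, assoc_inv_tmul, map_tmul, id_apply]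
    rw [← h']
    generalize t' (tmul φ d') = τ
    induction τ using tensor_induction with
    | add y y' hy hy' => simp only [add_tmul, map_add, hy, hy']
    | tmul e ψ => rw [assoc_inv_tmul, map_tmul, id_apply, evalAt_tmul, evalAt_tmul, h]

/-- Pasting of two squares with trivial coring sides, as in vertical composites of 2-cells. -/
theorem IsMate₂.paste₂ {M' : Bimodule B' A} {M'' : Bimodule B'' A} {a : D.tensor M ⟶ M'}
    {b : (dual M').tensor D ⟶ dual M}
    {a' : D'.tensor M' ⟶ M''} {b' : (dual M'').tensor D' ⟶ dual M'}
    (h : IsMate₂ a b) (h' : IsMate₂ a' b') :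
    IsMate₂ ((assoc D' D M).inv ≫ map (𝟙 _) a ≫ a')
      ((assoc (dual M'') D' D).hom ≫ map b' (𝟙 _) ≫ b) := by
  intro φ d x
  induction d using tensor_induction with
  | add d d' hd hd' => simp only [tmul_add, add_tmul, map_add, dual_add, hd, hd']
  | tmul d' d =>
    simp only [comp_apply, assoc_hom_tmul, assoc_inv_tmul, map_tmul, id_apply]
    rw [h, h']

end
end Bim.Bimodule

/-! ### Cells of `REM(Bim)` and `LEM(Bim)` under mates -/

namespace Bim.Bimodule
variable {k : Type v} [CommRing k] {X Y : REM (Bim.{u} k)}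

/-- The axioms of a 1-cell of `REM(Bim)`, with the composites spelled out in terms of bimodules. -/
theorem isCell_iff (M : Bimodule Y.base X.base)
    (s : tensor (A := Y.base) Y.cell M ⟶ M.tensor (C := X.base) X.cell) :
    REM.IsCell X Y M s ↔
      (s ≫ map (𝟙 M) X.counit ≫ (tensorRegular M).hom =
        map Y.counit (𝟙 M) ≫ (regularTensor M).hom) ∧
      s ≫ map (𝟙 M) X.comul = map Y.comul (𝟙 M) ≫ (assoc Y.cell Y.cell M).inv ≫
        map (𝟙 _) s ≫ (assoc Y.cell M X.cell).hom ≫ map s (𝟙 _) ≫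
        (assoc M X.cell X.cell).inv :=
  ⟨fun h => ⟨h.1, h.2⟩, fun h => ⟨h.1, h.2⟩⟩

/-- The axioms of a 1-cell of `LEM(Bim)`, with the composites spelled out in terms of bimodules. -/
theorem isCell_op_iff (N : Bimodule X.base Y.base)
    (t : tensor (C := Y.base) N Y.cell ⟶ tensor (A := X.base) X.cell N) :
    REM.IsCell X.op Y.op (Quiver.Hom.op (X := Y.base) (Y := X.base) N) (.op2' t) ↔
      (t ≫ map X.counit (𝟙 N) ≫ (regularTensor N).hom =
        map (𝟙 N) Y.counit ≫ (tensorRegular N).hom) ∧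
      t ≫ map X.comul (𝟙 N) = map (𝟙 N) Y.comul ≫ (assoc N Y.cell Y.cell).hom ≫
        map t (𝟙 _) ≫ (assoc X.cell N Y.cell).inv ≫ map (𝟙 _) t ≫
        (assoc X.cell X.cell N).hom :=
  ⟨fun h => ⟨congrArg (·.unop2) h.1, congrArg (·.unop2) h.2⟩,
    fun h => ⟨congrArg Bicategory.Opposite.Hom2.op2' h.1,
      congrArg Bicategory.Opposite.Hom2.op2' h.2⟩⟩

/-- The axiom of a 2-cell of `REM(Bim)`, spelled out in terms of bimodules. -/
theorem isCell₂_iff (S T : REM.Cell X Y)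
    (a : tensor (A := Y.base) (C := X.base) Y.cell S.f ⟶ T.f) :
    REM.IsCell₂ S T a ↔
      map Y.comul (𝟙 S.f) ≫ (assoc Y.cell Y.cell S.f).inv ≫ map (𝟙 Y.cell) S.s ≫
        (assoc Y.cell S.f X.cell).hom ≫ map a (𝟙 X.cell) =
      map Y.comul (𝟙 S.f) ≫ (assoc Y.cell Y.cell S.f).inv ≫ map (𝟙 Y.cell) a ≫ T.s :=
  Iff.rfl

/-- The axiom of a 2-cell of `LEM(Bim)`, spelled out in terms of bimodules. -/
theorem isCell₂_op_iff (S T : REM.Cell X.op Y.op)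
    (b : tensor (A := X.base) (C := Y.base) S.f.unop Y.cell ⟶ T.f.unop) :
    REM.IsCell₂ S T (.op2' b) ↔
      map (𝟙 S.f.unop) Y.comul ≫ (assoc S.f.unop Y.cell Y.cell).hom ≫
        map S.s.unop2 (𝟙 Y.cell) ≫ (assoc X.cell S.f.unop Y.cell).inv ≫ map (𝟙 X.cell) b =
      map (𝟙 S.f.unop) Y.comul ≫ (assoc S.f.unop Y.cell Y.cell).hom ≫
        map b (𝟙 Y.cell) ≫ T.s.unop2 :=
  ⟨fun h => congrArg (·.unop2) h, fun h => congrArg Bicategory.Opposite.Hom2.op2' h⟩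

/-- The mate of `s` is a 1-cell structure on `M*` exactly if `s` is one on `M`. -/
theorem IsMate.isCell_iff {M : Bimodule Y.base X.base} (β : DualBasis M)
    {s : tensor (A := Y.base) Y.cell M ⟶ M.tensor (C := X.base) X.cell}
    {t : (dual M).tensor (C := Y.base) Y.cell ⟶ tensor (A := X.base) X.cell (dual M)}
    (h : IsMate s t) :
    REM.IsCell X.op Y.op (Quiver.Hom.op (X := Y.base) (Y := X.base) (dual M)) (.op2' t) ↔
      REM.IsCell X Y M s := by
  rw [Bimodule.isCell_iff, isCell_op_iff]
  exact and_congr ((h.counit X.counit).eq_iff β (isMate₂_counit Y.counit)).symm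
    ((h.comp X.comul).eq_iff β β ((h.paste h).precomp Y.comul)).symm

/-- The mate of `a` is a 2-cell of `LEM(Bim)` exactly if `a` is a 2-cell of `REM(Bim)`. -/
theorem IsMate₂.isCell₂_iff {S T : REM.Cell X Y} (β : DualBasis (B := Y.base) (A := X.base) S.f)
    (β' : DualBasis (B := Y.base) (A := X.base) T.f)
    {s : (dual (B := Y.base) (A := X.base) S.f).tensor (C := Y.base) Y.cell ⟶
      tensor (A := X.base) X.cell (dual (B := Y.base) (A := X.base) S.f)}
    (hs : IsMate (M := S.f) (M' := S.f) (D := Y.cell) (E := X.cell) S.s s)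
    {t : (dual (B := Y.base) (A := X.base) T.f).tensor (C := Y.base) Y.cell ⟶
      tensor (A := X.base) X.cell (dual (B := Y.base) (A := X.base) T.f)}
    (ht : IsMate (M := T.f) (M' := T.f) (D := Y.cell) (E := X.cell) T.s t)
    (hs' ht') {a : tensor (A := Y.base) (C := X.base) Y.cell S.f ⟶ T.f}
    {b : (dual (B := Y.base) (A := X.base) T.f).tensor (C := Y.base) Y.cell ⟶ dual S.f}
    (h : IsMate₂ a b) :
    REM.IsCell₂
      (REM.Cell.mk (X := X.op) (Y := Y.op)
        (Quiver.Hom.op (X := Y.base) (Y := X.base) (dual T.f)) (.op2' t) ht')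
      (REM.Cell.mk (X := X.op) (Y := Y.op)
        (Quiver.Hom.op (X := Y.base) (Y := X.base) (dual S.f)) (.op2' s) hs') (.op2' b) ↔
      REM.IsCell₂ S T a := by
  refine (isCell₂_op_iff _ _ _).trans (Iff.trans ?_ (Bimodule.isCell₂_iff S T a).symm)
  exact eq_comm.trans
    (((hs.paste₂ h).precomp Y.comul).eq_iff β β' ((h.paste ht).precomp Y.comul)).symm

theorem isLeftFGP_dual {A B : Bim.{u} k} {M : Bimodule B A} (h : IsRightFGP M) :
    IsLeftFGP (dual M) := by
  obtain ⟨β⟩ := (isRightFGP_iff M).1 h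
  exact (finite_projective_iff _ _).2 ⟨β.n, β.e', fun i =>
    { toFun := fun φ => φ (β.e i), map_add' := fun _ _ => rfl, map_smul' := fun _ _ => rfl },
    β.sum_dual⟩

end Bim.Bimodule

section
variable {k : Type v} [CommRing k]
open Bim.Bimodule

theorem fREM.isMate_starMap {X Y : fREM.{u} k} (S : X ⟶ Y) :
    IsMate (M := S.obj.f) (M' := S.obj.f) (D := Y.as.cell) (E := X.as.cell) S.obj.s
      (starMap S).unop2 := isMate_lowerStar _ _

theorem fREM.isMate₂_starMap₂ {X Y : fREM.{u} k} {S T : X ⟶ Y} (a : S ⟶ T) :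
    IsMate₂ (M := S.obj.f) (M' := T.obj.f) (D := Y.as.cell) a.hom.hom
      (starMap₂ a).unop2 := isMate₂_lowerStar₂ _ _

/-- The map `a_*` is the only mate of `a`. -/
theorem fREM.starMap₂_eq {X Y : fREM.{u} k} {S T : X ⟶ Y} (a : S ⟶ T)
    {b : starBimodule T ≫ Y.as.op.cell ⟶ starBimodule S}
    (h : IsMate₂ (M := S.obj.f) (M' := T.obj.f) (D := Y.as.cell) a.hom.hom b.unop2) :
    starMap₂ a = b :=
  congrArg Bicategory.Opposite.Hom2.op2'
    (((fREM.isMate₂_starMap₂ a).eq_iff (fREM.dualBasis T) h).1 rfl)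

variable (k) in
/-- The laws of `(-)_*`: in each of them, both sides are mates of the two sides of the corresponding
identity in `REM(Bim)`. -/
theorem dualityLaws : DualityLaws.{u} k where
  lowerStar_eq β β' D E s := ((isMate_lowerStar β s).eq_iff β β (isMate_lowerStar β' s)).1 rfl
  lowerStar₂_eq {A B M M'} β β' D a := tensor_hom_ext fun φ d => dual_ext fun x =>
    (isMate₂_lowerStar₂ β a φ d x).trans (isMate₂_lowerStar₂ β' a φ d x).symm
  isLeftFGP S := isLeftFGP_dual S.property
  isCell S := ((fREM.isMate_starMap S).isCell_iff (fREM.dualBasis S)).2 S.obj.isCell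
  isCell₂ {X Y S T} a := ((fREM.isMate₂_starMap₂ a).isCell₂_iff (fREM.dualBasis S)
    (fREM.dualBasis T) (fREM.isMate_starMap S) (fREM.isMate_starMap T) _ _).2 a.hom.isCell₂
  map_id {X Y} S := fREM.starMap₂_eq _ (by
    have h := isMate₂_counit (M := S.obj.f) Y.as.counit
    exact REM.id_hom S.obj ▸ h)
  map_comp {X Y S T U} a b := fREM.starMap₂_eq _
    (((fREM.isMate₂_starMap₂ a).paste₂ (fREM.isMate₂_starMap₂ b)).precomp Y.as.comul)
end

/-! ### Full faithfulness of the duality functor -/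
section
variable {k : Type v} [CommRing k]
open Bim.Bimodule

instance dualityFunctor_faithful (h : DualityLaws.{u} k) (X Y : fREM.{u} k) :
    (dualityFunctor h X Y).Faithful where
  map_injective {S T} a b hab := by
    have h' : starMap₂ a = starMap₂ b := congrArg
      (fun c : (dualityFunctor h X Y).obj S ⟶ (dualityFunctor h X Y).obj T =>
        (Conj.un₂ c).hom.hom) hab
    exact ObjectProperty.hom_ext _ (REM.hom_ext
      (((fREM.isMate₂_starMap₂ a).eq_iff (fREM.dualBasis T) (fREM.isMate₂_starMap₂ b)).2
        (congrArg (·.unop2) h')))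

instance dualityFunctor_full (h : DualityLaws.{u} k) (X Y : fREM.{u} k) :
    (dualityFunctor h X Y).Full where
  map_surjective {S T} c := by
    let b := (Conj.un₂ c).hom
    obtain ⟨a, ha⟩ := exists_isMate₂ (M := S.obj.f) (M' := T.obj.f) (D := Y.as.cell)
      (fREM.dualBasis T) b.hom.unop2
    have ha' : REM.IsCell₂ S.obj T.obj a := (ha.isCell₂_iff (fREM.dualBasis S)
      (fREM.dualBasis T) (fREM.isMate_starMap S) (fREM.isMate_starMap T) _ _).1 b.isCell₂
    let f : S ⟶ T := ObjectProperty.homMk (REM.Cell₂.mk a ha')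
    exact ⟨f, Conj.hom_ext (ObjectProperty.hom_ext _ (REM.hom_ext (fREM.starMap₂_eq f ha)))⟩
end

/-! ### Left duals and essential surjectivity -/

namespace Bim.Bimodule
variable {k : Type v} [CommRing k] {A B : Bim.{u} k}

/-- The left dual `*N = Hom_A(_A N, _A A)` of an `(A, B)`-bimodule, with the `(B, A)`-bimodule
structure `(b f a)(x) = f(x b) a`. -/
def leftDual (N : Bimodule A B) : Bimodule B A :=
  letI : Module B (N →ₗ[A] A) :=
    { smul b f :=
        { toFun := fun x => f (op b • x)
          map_add' := fun x y => by rw [smul_add, map_add]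
          map_smul' := fun a x => by rw [← smul_comm, map_smul]; rfl }
      one_smul f := LinearMap.ext fun x => congrArg f (one_smul Bᵐᵒᵖ x)
      mul_smul b b' f := LinearMap.ext fun x => congrArg f (mul_smul (op b') (op b) x)
      smul_zero b := rfl
      smul_add b f g := rfl
      add_smul b b' f := LinearMap.ext fun x =>
        (congrArg f (add_smul (op b) (op b') x)).trans (map_add f _ _)
      zero_smul f := LinearMap.ext fun x => (congrArg f (zero_smul Bᵐᵒᵖ x)).trans (map_zero f) }
  { carrier := N →ₗ[A] A
    comm := ⟨fun _ _ _ => rfl⟩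
    central := fun c f => LinearMap.ext fun x => by
      change f (op (algebraMap k B c) • x) = f x * algebraMap k A c
      rw [← N.central, map_smul, ← Algebra.commutes]
      rfl }

instance (N : Bimodule A B) : FunLike (leftDual N) N A :=
  inferInstanceAs (FunLike (N →ₗ[A] A) N A)

section
variable {N : Bimodule A B}

theorem leftDual_ext {f g : leftDual N} (h : ∀ x, f x = g x) : f = g := DFunLike.ext f g h

theorem leftDual_op_smul (a : A) (f : leftDual N) (x : N) : (op a • f) x = f x * a := rfl

theorem leftDual_sum {ι : Type*} (s : Finset ι) (f : ι → leftDual N) (x : N) :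
    (∑ i ∈ s, f i) x = ∑ i ∈ s, f i x :=
  map_sum (AddMonoidHom.mk' (fun f : leftDual N => f x) (fun _ _ => rfl)) f s

theorem leftDual_map_sum {ι : Type*} (s : Finset ι) (f : leftDual N) (a : ι → A) (x : ι → N) :
    f (∑ i ∈ s, a i • x i) = ∑ i ∈ s, a i * f (x i) :=
  (map_sum (show N →ₗ[A] A from f) _ s).trans
    (Finset.sum_congr rfl fun _ _ => LinearMap.map_smul (show N →ₗ[A] A from f) _ _)
end

/-- The canonical map `N ⟶ (*N)*`. -/
def toDualLeftDual (N : Bimodule A B) : N ⟶ dual (leftDual N) where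
  toFun x := ({ toFun := fun f : N →ₗ[A] A => f x
                map_add' := fun _ _ => rfl
                map_smul' := fun _ _ => rfl } : (N →ₗ[A] A) →ₗ[Aᵐᵒᵖ] A)
  map_zero' := LinearMap.ext fun f : N →ₗ[A] A => map_zero f
  map_add' x y := LinearMap.ext fun f : N →ₗ[A] A => map_add f x y
  map_smul a x := LinearMap.ext fun f : N →ₗ[A] A => map_smul f a x
  map_op_smul _ _ := rfl

theorem toDualLeftDual_apply {N : Bimodule A B} (x : N) (f : leftDual N) :
    toDualLeftDual N x f = f x := rfl

/-- If `_A N` is finitely generated and projective, then so is `(*N)_A`, and `N` is the right dual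
of `*N`: a finite dual basis of `_A N` is also one of `(*N)_A`, with the two halves exchanged. -/
theorem IsLeftFGP.leftDual {N : Bimodule A B} (hN : IsLeftFGP N) :
    Nonempty (DualBasis (leftDual N)) ∧ Function.Bijective (toDualLeftDual N) := by
  obtain ⟨n, e, e₀, h₀⟩ := (finite_projective_iff _ _).1 hN
  let e' (i) : Bimodule.leftDual N := e₀ i
  have h (x : N) : ∑ i, e' i x • e i = x := h₀ x
  have hβ (f : Bimodule.leftDual N) : ∑ i, op (f (e i)) • e' i = f := leftDual_ext fun x => by
    conv_rhs => rw [← h x, leftDual_map_sum]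
    simp only [leftDual_sum, leftDual_op_smul]
  refine ⟨⟨n, e', fun i => toDualLeftDual N (e i), hβ⟩, fun x y hxy => ?_, fun φ => ?_⟩
  · rw [← h x, ← h y]
    simp only [← toDualLeftDual_apply, hxy]
  · refine ⟨∑ i, φ (e' i) • e i, dual_ext fun f => ?_⟩
    conv_rhs => rw [← hβ f, map_sum]
    simp only [toDualLeftDual_apply, leftDual_map_sum, dual_map_op_smul]

/-- A bijective bilinear map is an isomorphism. -/
noncomputable def isoOfBijective {M N : Bimodule A B} (f : M ⟶ N) (hf : Function.Bijective f) :
    M ≅ N :=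
  let e := Equiv.ofBijective f hf
  have he (y : N) : f (e.symm y) = y := e.apply_symm_apply y
  { hom := f
    inv :=
      { toFun := e.symm
        map_zero' := hf.1 (by rw [he, map_zero])
        map_add' := fun x y => hf.1 (by rw [he, map_add, he, he])
        map_smul := fun a x => hf.1 (by rw [he, hom_smul, he])
        map_op_smul := fun a x => hf.1 (by rw [he, hom_op_smul, he]) }
    hom_inv_id := hom_ext fun x => e.symm_apply_apply x
    inv_hom_id := hom_ext fun x => e.apply_symm_apply x }

end Bim.Bimodule

namespace REM
variable {B : Type u} [Bicategory.{w, v} B] {X Y : REM B}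

/-- A 1-cell structure on `f` transported along an isomorphism `f ≅ g`. -/
def transport (S : X ⟶ Y) {g : X.base ⟶ Y.base} (u : S.f ≅ g) : X ⟶ Y where
  f := g
  s := u.inv ▷ Y.cell ≫ S.s ≫ X.cell ◁ u.hom
  isCell :=
  { counit := by
      have h := S.isCell.counit
      calc _ = u.inv ▷ Y.cell ≫ S.s ≫ (X.cell ◁ u.hom ≫ X.counit ▷ g) ≫ (λ_ g).hom := by simp
        _ = u.inv ▷ Y.cell ≫ (S.s ≫ X.counit ▷ S.f ≫ (λ_ S.f).hom) ≫ u.hom := by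
          rw [whisker_exchange]; simp
        _ = (u.inv ▷ Y.cell ≫ S.f ◁ Y.counit) ≫ (ρ_ S.f).hom ≫ u.hom := by rw [h]; simp
        _ = _ := by rw [← whisker_exchange]; simp
    comul := by
      have h := S.isCell.comul
      -- the identity between the two copies of `S.s` is expanded to `u.hom ≫ u.inv` at the end
      calc _ = u.inv ▷ Y.cell ≫ S.s ≫ (X.cell ◁ u.hom ≫ X.comul ▷ g) := by simp
        _ = u.inv ▷ Y.cell ≫ (S.s ≫ X.comul ▷ S.f) ≫ (X.cell ≫ X.cell) ◁ u.hom := by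
          rw [whisker_exchange]; simp
        _ = (u.inv ▷ Y.cell ≫ S.f ◁ Y.comul) ⊗≫ S.s ▷ Y.cell ⊗≫ X.cell ◁ 𝟙 S.f ▷ Y.cell ⊗≫
              X.cell ◁ S.s ⊗≫ (X.cell ≫ X.cell) ◁ u.hom := by rw [h]; bicategory
        _ = _ := by rw [← whisker_exchange, ← u.hom_inv_id]; bicategory }

theorem comp_transport_s (S : X ⟶ Y) {g : X.base ⟶ Y.base} (u : S.f ≅ g) :
    S.s ≫ X.cell ◁ u.hom = u.hom ▷ Y.cell ≫ (transport S u).s := by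
  simp [transport]

end REM

section
variable {k : Type v} [CommRing k]
open Bim.Bimodule

/-- A 1-cell of `fLEM(Bim)` on `Ξ` is transported along `Ξ ≅ (*Ξ)*` to one on `(*Ξ)*`, whose
structure map is the mate of a unique structure map on the left dual `*Ξ`. -/
instance dualityFunctor_essSurj (h : DualityLaws.{u} k) (X Y : fREM.{u} k) :
    (dualityFunctor h X Y).EssSurj where
  mem_essImage T := by
    let S : X.as.op ⟶ Y.as.op := (Conj.un T).obj
    have hS : IsLeftFGP S.f.unop := (Conj.un T).property
    let M : Bim.Bimodule Y.as.base X.as.base := leftDual S.f.unop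
    obtain ⟨⟨β⟩, hj⟩ := hS.leftDual
    let u : S.f ≅ Quiver.Hom.op (X := Y.as.base) (Y := X.as.base) (dual M) :=
      Iso.op2_unop (isoOfBijective _ hj)
    let S' := REM.transport S u
    obtain ⟨s, hs⟩ := exists_isMate (M := M) (M' := M) (D := Y.as.cell) (E := X.as.cell) β
      S'.s.unop2
    let R : X ⟶ Y := ⟨REM.Cell.mk M s ((hs.isCell_iff β).1 S'.isCell), (isRightFGP_iff _).2 ⟨β⟩⟩
    have hR : starMap R = S'.s := congrArg Bicategory.Opposite.Hom2.op2'
      (((fREM.isMate_starMap R).eq_iff β β hs).1 rfl)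
    let e : S ≅ starCell h R := REM.isoStrict u 
      ((REM.comp_transport_s S u).trans (congrArg (u.hom ▷ Y.as.op.cell ≫ ·) hR.symm))
    exact ⟨R, ⟨Conj.iso₂ (ObjectProperty.isoMk _ e.symm)⟩⟩

instance dualityFunctor_isEquivalence (h : DualityLaws.{u} k) (X Y : fREM.{u} k) :
    (dualityFunctor h X Y).IsEquivalence where
end

/-! ### Duals of tensor products -/

namespace Bim.Bimodule
variable {k : Type v} [CommRing k] {A B C D : Bim.{u} k}

/-- The transpose `u* : M'* ⟶ M*` of `u : M ⟶ M'`. -/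
def dualMap {M M' : Bimodule B A} (u : M ⟶ M') : dual M' ⟶ dual M where
  toFun φ := ({ toFun := fun x => φ (u x)
                map_add' := fun x y => by rw [map_add, map_add]
                map_smul' := fun a x => by
                  obtain ⟨a, rfl⟩ := op_surjective a
                  rw [hom_op_smul, dual_map_op_smul]; rfl } : M →ₗ[Aᵐᵒᵖ] A)
  map_zero' := rfl
  map_add' _ _ := rfl
  map_smul _ _ := rfl
  map_op_smul b φ := dual_ext fun x => congrArg φ (hom_smul u b x).symm

@[simp] theorem dualMap_apply {M M' : Bimodule B A} (u : M ⟶ M') (φ : dual M') (x : M) :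
    dualMap u φ x = φ (u x) := rfl

/-- The transpose of `u`, seen as a 2-cell with the counit inserted, is a mate of `u`. -/
theorem isMate₂_strict {M M' : Bimodule B A} (u : M ⟶ M') {D : Bimodule B B}
    (f : D ⟶ regular B) :
    IsMate₂ (map f (𝟙 M) ≫ (regularTensor M).hom ≫ u)
      (map (𝟙 (dual M')) f ≫ (tensorRegular _).hom ≫ dualMap u) := fun φ d x => by
  simp only [comp_apply, map_tmul, regularTensor_tmul, tensorRegular_tmul, id_apply,
    dualMap_apply, dual_op_smul, hom_smul]

/-- The canonical map `A ⟶ A*`, `a ↦ (x ↦ a x)`. -/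
def regularToDual (A : Bim.{u} k) : regular A ⟶ dual (regular A) where
  toFun a := ({ toFun := fun x => ofRegular a * ofRegular x
                map_add' := fun x y => mul_add (ofRegular a) (ofRegular x) (ofRegular y)
                map_smul' := fun b x => (mul_assoc (ofRegular a) (ofRegular x) b.unop).symm } : regular A →ₗ[Aᵐᵒᵖ] A)
  map_zero' := dual_ext fun x => zero_mul (ofRegular x)
  map_add' a b := dual_ext fun x => add_mul (ofRegular a) (ofRegular b) (ofRegular x)
  map_smul a b := dual_ext fun x => mul_assoc a (ofRegular b) (ofRegular x)
  map_op_smul a b := dual_ext fun x => mul_assoc (ofRegular b) a (ofRegular x)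

theorem regularToDual_apply (a x : regular A) :
    regularToDual A a x = ofRegular a * ofRegular x := rfl

theorem regularToDual_bijective (A : Bim.{u} k) : Function.Bijective (regularToDual A) := by
  refine ⟨fun a b h => ?_, fun φ => ⟨toRegular (φ (toRegular 1)), dual_ext fun x => ?_⟩⟩
  · have h' : ofRegular a * 1 = ofRegular b * 1 :=
      congrArg (fun φ : dual (regular A) => φ (toRegular 1)) h
    rwa [mul_one, mul_one] at h'
  · have h := dual_map_op_smul φ (ofRegular x) (toRegular 1)
    rw [← toRegular_mul', one_mul] at h
    exact h.symm

/-- The canonical map `N* ⊗ M* ⟶ (M ⊗ N)*`, `ψ ⊗ φ ↦ (m ⊗ n ↦ ψ(φ(m) n))`. -/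
def tensorDual (M : Bimodule C B) (N : Bimodule B A) :
    (dual N).tensor (dual M) ⟶ dual (M.tensor N) :=
  lift (fun ψ φ => ({ toFun := fun t => ψ (contract φ t)
                      map_add' := fun x y => by rw [map_add, map_add]
                      map_smul' := fun a x => by
                        obtain ⟨a, rfl⟩ := op_surjective a
                        rw [contract_map_op_smul, dual_map_op_smul]; rfl } :
                    M.tensor N →ₗ[Aᵐᵒᵖ] A))
    (fun ψ ψ' φ => rfl)
    (fun ψ φ φ' => dual_ext fun t => (congrArg ψ (contract_add φ φ' t)).trans (map_add _ _ _))
    (fun ψ b φ => dual_ext fun t => (congrArg ψ (contract_smul b φ t)).symm)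
    (fun a ψ φ => rfl)
    (fun ψ φ c => dual_ext fun t => congrArg ψ (contract_op_smul c φ t))

section
variable {M : Bimodule C B} {N : Bimodule B A}

theorem tensorDual_apply (ψ : dual N) (φ : dual M) (t : M.tensor N) :
    tensorDual M N (tmul ψ φ) t = ψ (contract φ t) :=
  congrArg (fun χ : dual (M.tensor N) => χ t) (lift_tmul ..)

theorem tensorDual_apply_tmul (τ : (dual N).tensor (dual M)) (m : M) (n : N) :
    tensorDual M N τ (tmul m n) = evalAt m τ n := by
  induction τ using tensor_induction with
  | tmul ψ φ => rw [tensorDual_apply, contract_tmul, evalAt_tmul, dual_op_smul]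
  | add τ τ' h h' => simp only [map_add, dual_add, h, h']

theorem dual_tensor_ext {χ χ' : dual (M.tensor N)} (h : ∀ m n, χ (tmul m n) = χ' (tmul m n)) :
    χ = χ' := dual_ext fun t => by
  induction t using tensor_induction with
  | tmul m n => exact h m n
  | add x y hx hy => rw [map_add, map_add, hx, hy]

theorem DualBasis.tensorDual_bijective (β : DualBasis M) (N : Bimodule B A) :
    Function.Bijective (tensorDual M N) := by
  refine ⟨fun τ τ' h => β.evalAt_ext fun m => dual_ext fun n => ?_, fun χ => ?_⟩
  · rw [← tensorDual_apply_tmul, ← tensorDual_apply_tmul, h]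
  · let χ' (m : M) : dual N := ({ toFun := fun n => χ (tmul m n)
                                  map_add' := fun x y => by rw [tmul_add, map_add]
                                  map_smul' := fun a x => by
                                    obtain ⟨a, rfl⟩ := op_surjective a
                                    rw [← op_smul_tmul, dual_map_op_smul]; rfl } : N →ₗ[Aᵐᵒᵖ] A)
    refine ⟨∑ i, tmul (χ' (β.e i)) (β.e' i), dual_tensor_ext fun m n => ?_⟩
    rw [tensorDual_apply_tmul, map_sum, dual_sum]
    simp only [evalAt_tmul, dual_op_smul]
    change ∑ i, χ (tmul (β.e i) (β.e' i m • n)) = _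
    simp only [← balanced]
    rw [← map_sum, ← sum_tmul, β.sum_eq]

theorem evalAt_tensorDual {E : Bimodule D A} (t : E.tensor (dual N)) (φ : dual M) (m : M) (n : N) :
    evalAt (tmul m n) (map (𝟙 E) (tensorDual M N) ((assoc E (dual N) (dual M)).inv (tmul t φ))) =
      evalAt (φ m • n) t := by
  induction t using tensor_induction with
  | tmul e ψ => simp only [assoc_inv_tmul, map_tmul, id_apply, evalAt_tmul, tensorDual_apply,
      contract_tmul]
  | add t t' h h' => simp only [add_tmul, map_add, h, h']

theorem contract_tensorDual {E : Bimodule A D} (ψ : dual N) (φ : dual M) (m : M) (t : N.tensor E) :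
    contract (tensorDual M N (tmul ψ φ)) ((assoc M N E).hom (tmul m t)) =
      contract ψ (φ m • t) := by
  induction t using tensor_induction with
  | tmul n e => simp only [assoc_hom_tmul, contract_tmul, tensorDual_apply, smul_tmul]
  | add t t' h h' => simp only [tmul_add, smul_add, map_add, h, h']

variable {M' : Bimodule C B} {N' : Bimodule B A} {F : Bimodule C C} {G : Bimodule B B}
  {E : Bimodule A A}

/-- The canonical map `N* ⊗ M* ⟶ (M ⊗ N)*` intertwines the composite of the mates of `s` and `s'`
with the mate of the composite. -/
theorem IsMate.tensorDual (β : DualBasis (M.tensor N)) {s : F.tensor M ⟶ M.tensor G}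
    {t : (dual M).tensor F ⟶ G.tensor (dual M)} (h : IsMate s t)
    {s' : G.tensor N ⟶ N.tensor E} {t' : (dual N).tensor G ⟶ E.tensor (dual N)}
    (h' : IsMate s' t')
    {t'' : (dual (M.tensor N)).tensor F ⟶ E.tensor (dual (M.tensor N))}
    (h'' : IsMate ((assoc F M N).hom ≫ map s (𝟙 N) ≫ (assoc M G N).inv ≫ map (𝟙 M) s' ≫
      (assoc M N E).hom) t'') :
    ((assoc (dual N) (dual M) F).inv ≫ map (𝟙 _) t ≫ (assoc (dual N) G (dual M)).hom ≫
      map t' (𝟙 _) ≫ (assoc E (dual N) (dual M)).inv) ≫ map (𝟙 E) (tensorDual M N) =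
      map (tensorDual M N) (𝟙 F) ≫ t'' := by
  refine hom_ext₃' fun ψ φ d => β.evalAt_ext fun x => ?_
  induction x using tensor_induction with
  | add x x' hx hx' => rw [evalAt_add, evalAt_add, hx, hx']
  | tmul m n =>
    simp only [comp_apply, map_tmul, id_apply, assoc_inv_tmul]
    rw [h'']
    simp only [comp_apply, assoc_hom_tmul, map_tmul, id_apply]
    have h1 (τ : G.tensor (dual M)) : evalAt (tmul m n) (map (𝟙 E) (Bimodule.tensorDual M N)
        ((assoc E (dual N) (dual M)).inv (map t' (𝟙 _)
          ((assoc (dual N) G (dual M)).hom (tmul ψ τ))))) =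
        contract ψ (s' (tmul (evalAt m τ) n)) := by
      induction τ using tensor_induction with
      | add x x' hx hx' => simp only [tmul_add, add_tmul, map_add, hx, hx']
      | tmul g χ =>
        rw [assoc_hom_tmul, map_tmul, id_apply, evalAt_tensorDual, h', evalAt_tmul, balanced]
    rw [h1, h]
    generalize s (tmul d m) = σ
    induction σ using tensor_induction with
    | add x x' hx hx' => simp only [add_tmul, map_add, hx, hx']
    | tmul m' g =>
      rw [assoc_inv_tmul, map_tmul, id_apply, contract_tensorDual, contract_tmul, ← smul_tmul,
        hom_smul]

/-- Naturality in `M` of the canonical map `N* ⊗ M* ⟶ (M ⊗ N)*`, for mates. -/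
theorem IsMate₂.tensorDual_left {a : F.tensor M ⟶ M'} {b : (dual M').tensor F ⟶ dual M}
    (h : IsMate₂ a b) {c : (dual (M'.tensor N)).tensor F ⟶ dual (M.tensor N)}
    (h' : IsMate₂ ((assoc F M N).hom ≫ map a (𝟙 N)) c) :
    map (tensorDual M' N) (𝟙 F) ≫ c =
      ((assoc (dual N) (dual M') F).inv ≫ map (𝟙 _) b) ≫ tensorDual M N := by
  refine hom_ext₃' fun ψ φ d => dual_tensor_ext fun m n => ?_
  simp only [comp_apply, map_tmul, id_apply, assoc_inv_tmul]
  rw [h']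
  simp only [comp_apply, assoc_hom_tmul, map_tmul, id_apply, tensorDual_apply, contract_tmul]
  rw [h]

/-- Naturality in `N` of the canonical map `N* ⊗ M* ⟶ (M ⊗ N)*`, for mates: `a` is a 2-cell, whose
horizontal composite with the identity of `(M, s)` involves `s`. -/
theorem IsMate.tensorDual_right {s : F.tensor M ⟶ M.tensor G}
    {t : (dual M).tensor F ⟶ G.tensor (dual M)} (h : IsMate s t)
    {a : G.tensor N ⟶ N'} {b : (dual N').tensor G ⟶ dual N} (h' : IsMate₂ a b)
    {c : (dual (M.tensor N')).tensor F ⟶ dual (M.tensor N)}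
    (h'' : IsMate₂ ((assoc F M N).hom ≫ map s (𝟙 N) ≫ (assoc M G N).inv ≫ map (𝟙 M) a) c) :
    map (Bimodule.tensorDual M N') (𝟙 F) ≫ c =
      ((assoc (dual N') (dual M) F).inv ≫ map (𝟙 _) t ≫ (assoc (dual N') G (dual M)).hom ≫
        map b (𝟙 _)) ≫ Bimodule.tensorDual M N := by
  refine hom_ext₃' fun ψ φ d => dual_tensor_ext fun m n => ?_
  simp only [comp_apply, map_tmul, id_apply, assoc_inv_tmul]
  rw [h'']
  simp only [comp_apply, assoc_hom_tmul, map_tmul, id_apply]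
  have h1 (τ : G.tensor (dual M)) : Bimodule.tensorDual M N (map b (𝟙 _)
      ((assoc (dual N') G (dual M)).hom (tmul ψ τ))) (tmul m n) =
      ψ (a (tmul (evalAt m τ) n)) := by
    induction τ using tensor_induction with
    | add x x' hx hx' => simp only [tmul_add, add_tmul, map_add, dual_add, hx, hx']
    | tmul g χ =>
      rw [assoc_hom_tmul, map_tmul, id_apply, tensorDual_apply, contract_tmul, h', evalAt_tmul,
        balanced]
  rw [h1, h]
  generalize s (tmul d m) = σ
  induction σ using tensor_induction with
  | add x x' hx hx' => simp only [add_tmul, map_add, hx, hx']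
  | tmul m' g =>
    rw [assoc_inv_tmul, map_tmul, id_apply, tensorDual_apply, contract_tmul, contract_tmul,
      ← smul_tmul, hom_smul]

theorem tensorDual_assoc (L : Bimodule D C) (M : Bimodule C B) (N : Bimodule B A) :
    map (𝟙 (dual N)) (tensorDual L M) ≫ tensorDual (L.tensor M) N ≫
        dualMap (assoc L M N).hom =
      (assoc (dual N) (dual M) (dual L)).hom ≫ map (tensorDual M N) (𝟙 (dual L)) ≫
        tensorDual L (M.tensor N) := by
  refine hom_ext₃ fun χ ψ φ => dual_tensor_ext fun l x => ?_
  induction x using tensor_induction with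
  | add x x' hx hx' => rw [tmul_add, map_add, map_add, hx, hx']
  | tmul m n =>
    simp only [comp_apply, map_tmul, id_apply, assoc_hom_tmul, dualMap_apply, tensorDual_apply,
      contract_tmul, smul_tmul]

theorem dualMap_tensorRegular (M : Bimodule B A) :
    dualMap (tensorRegular M).hom =
      (regularTensor (dual M)).inv ≫ map (regularToDual A) (𝟙 (dual M)) ≫
        tensorDual M (regular A) := by
  rw [Iso.eq_inv_comp]
  refine tensor_hom_ext fun a φ => dual_tensor_ext fun m x => ?_
  simp only [comp_apply, map_tmul, id_apply, regularTensor_tmul, dualMap_apply, dual_smul,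
    tensorRegular_tmul, dual_map_op_smul, tensorDual_apply, contract_tmul, regularToDual_apply]
  exact mul_assoc (ofRegular a) (φ m) (ofRegular x)

theorem dualMap_regularTensor (M : Bimodule B A) :
    dualMap (regularTensor M).hom =
      (tensorRegular (dual M)).inv ≫ map (𝟙 (dual M)) (regularToDual B) ≫
        tensorDual (regular B) M := by
  rw [Iso.eq_inv_comp]
  refine tensor_hom_ext fun φ b => dual_tensor_ext fun b' m => ?_
  simp only [comp_apply, map_tmul, id_apply, regularTensor_tmul, dualMap_apply, dual_op_smul,
    tensorRegular_tmul, tensorDual_apply, contract_tmul, regularToDual_apply, mul_smul]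

/-- The canonical map `A ⟶ A*` is compatible with the mate of the structure map of the identity
1-cell. -/
theorem IsMate.regularToDual (β : DualBasis (regular A)) {E : Bimodule A A}
    {t : (dual (regular A)).tensor E ⟶ E.tensor (dual (regular A))}
    (h : IsMate ((tensorRegular E).hom ≫ (regularTensor E).inv) t) :
    ((regularTensor E).hom ≫ (tensorRegular E).inv) ≫ map (𝟙 E) (regularToDual A) =
      map (regularToDual A) (𝟙 E) ≫ t := by
  have h1 (e : E) : (regularTensor E).inv e = tmul (toRegular 1) e := rfl
  have h2 (e : E) : (tensorRegular E).inv e = tmul e (toRegular 1) := rfl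
  refine tensor_hom_ext fun a e => β.evalAt_ext fun x => ?_
  simp only [comp_apply, map_tmul, id_apply, regularTensor_tmul, h2]
  rw [h, comp_apply, tensorRegular_tmul, h1, contract_tmul, evalAt_tmul, regularToDual_apply,
    regularToDual_apply]
  change op (1 * ofRegular x) • ofRegular a • e = (ofRegular a * 1) • op (ofRegular x) • e
  rw [one_mul, mul_one]
  exact (smul_comm (ofRegular a) (op (ofRegular x)) e).symm

end
end Bim.Bimodule

/-! ### Strict 2-cells -/

namespace REM
variable {B : Type u} [Bicategory.{w, v} B] {X Y Z : REM B}

/-- The 2-cell `a` of `REM(B)` is `ε ⊗ u` for the 2-cell `u` of `B`. -/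
def IsStrict {S T : X ⟶ Y} (a : S ⟶ T) (u : S.f ⟶ T.f) : Prop :=
  a.hom = S.f ◁ Y.counit ≫ (ρ_ S.f).hom ≫ u

theorem IsStrict.hom_eq {S T : X ⟶ Y} {a b : S ⟶ T} {u v : S.f ⟶ T.f} (ha : IsStrict a u)
    (hb : IsStrict b v) (h : u = v) : a = b := by
  subst h
  exact REM.hom_ext (ha.trans hb.symm)

/-- Precomposition with a strict 2-cell is precomposition in `B`. -/
theorem IsStrict.comp_hom {S T U : X ⟶ Y} {a : S ⟶ T} {u : S.f ⟶ T.f} (ha : IsStrict a u)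
    (b : T ⟶ U) : (a ≫ b).hom = u ▷ Y.cell ≫ b.hom := by
  rw [REM.comp_hom, ha]
  simpa using congrArg (· ≫ b.hom) (REM.counit_strict Y S.f u)

/-- Postcomposition with a strict 2-cell is postcomposition in `B`. -/
theorem IsStrict.hom_comp {S T U : X ⟶ Y} (a : S ⟶ T) {b : T ⟶ U} {u : T.f ⟶ U.f}
    (hb : IsStrict b u) : (a ≫ b).hom = a.hom ≫ u := by
  rw [REM.comp_hom, hb]
  calc _ = S.f ◁ Y.comul ⊗≫ (a.hom ▷ Y.cell ≫ T.f ◁ Y.counit) ⊗≫ u := by bicategory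
    _ = (S.f ◁ Y.comul ⊗≫ S.f ◁ Y.cell ◁ Y.counit ⊗≫ 𝟙 (S.f ≫ Y.cell)) ⊗≫ a.hom ≫ u := by
      rw [← whisker_exchange]; bicategory
    _ = _ := by rw [Y.counit_right]; bicategory

theorem IsStrict.comp {S T U : X ⟶ Y} {a : S ⟶ T} {b : T ⟶ U} {u : S.f ⟶ T.f} {v : T.f ⟶ U.f}
    (ha : IsStrict a u) (hb : IsStrict b v) : IsStrict (a ≫ b) (u ≫ v) := by
  unfold IsStrict
  rw [hb.hom_comp, ha]
  simp

theorem IsStrict.whiskerLeft (W : X ⟶ Y) {S T : Y ⟶ Z} {b : S ⟶ T} {u : S.f ⟶ T.f}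
    (hb : IsStrict b u) : IsStrict (W ◁ b) (W.f ◁ u) := by
  change (whiskerL W b).hom = _
  rw [whiskerL_hom, hb]
  simp only [comp_f]; bicategory

theorem IsStrict.whiskerRight {W V : X ⟶ Y} {a : W ⟶ V} {u : W.f ⟶ V.f} (ha : IsStrict a u)
    (S : Y ⟶ Z) : IsStrict (a ▷ S) (u ▷ S.f) := by
  change (whiskerR a S).hom = _
  have hS := S.isCell.counit
  rw [whiskerR_hom, ha]
  simp only [comp_f]
  calc _ = 𝟙 _ ⊗≫ W.f ◁ (S.s ≫ Y.counit ▷ S.f ≫ (λ_ S.f).hom) ⊗≫ u ▷ S.f := by bicategory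
    _ = _ := by rw [hS]; bicategory

theorem isStrict_associator {V : REM B} (f : X ⟶ Y) (g : Y ⟶ Z) (h : Z ⟶ V) :
    IsStrict (α_ f g h).hom (α_ f.f g.f h.f).hom := rfl
theorem isStrict_associator_inv {V : REM B} (f : X ⟶ Y) (g : Y ⟶ Z) (h : Z ⟶ V) :
    IsStrict (α_ f g h).inv (α_ f.f g.f h.f).inv := rfl
theorem isStrict_leftUnitor (f : X ⟶ Y) : IsStrict (λ_ f).hom (λ_ f.f).hom := rfl
theorem isStrict_leftUnitor_inv (f : X ⟶ Y) : IsStrict (λ_ f).inv (λ_ f.f).inv := rfl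
theorem isStrict_rightUnitor (f : X ⟶ Y) : IsStrict (ρ_ f).hom (ρ_ f.f).hom := rfl
theorem isStrict_rightUnitor_inv (f : X ⟶ Y) : IsStrict (ρ_ f).inv (ρ_ f.f).inv := rfl

end REM

/-! ### The pseudofunctor -/

theorem Conj.un₂_associator_hom_hom {ι : Type*} {B : Type u} [Bicategory.{w, v} B]
    {S : SubData ι B} {a b c d : Conj S.Obj} (f : a ⟶ b) (g : b ⟶ c) (l : c ⟶ d) :
    (Conj.un₂ (α_ f g l).hom).hom =
      (α_ (Conj.un f).obj (Conj.un g).obj (Conj.un l).obj).inv := rfl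

section
variable {k : Type v} [CommRing k] (h : DualityLaws.{u} k)
open Bim.Bimodule Bicategory.Opposite

/-- The 2-cell `a_*` of `LEM(Bim)`. -/
noncomputable def starCell₂ {X Y : fREM.{u} k} {S T : X ⟶ Y} (a : S ⟶ T) :
    starCell h T ⟶ starCell h S := REM.Cell₂.mk (starMap₂ a) (h.isCell₂ a)

/-- The duality sends strict 2-cells to strict 2-cells, by transposition. -/
theorem isStrict_starCell₂ {X Y : fREM.{u} k} {S T : X ⟶ Y} {a : S ⟶ T}
    {u : S.obj.f ⟶ T.obj.f} (ha : REM.IsStrict a.hom u) :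
    REM.IsStrict (starCell₂ h a) (.op2' (dualMap (M := S.obj.f) (M' := T.obj.f) u)) := by
  have ha' : a.hom.hom = _ := ha
  refine fREM.starMap₂_eq a ?_
  rw [ha']
  exact isMate₂_strict (M := S.obj.f) (M' := T.obj.f) u Y.as.counit

/-- The isomorphism `(W*, w_*) ∘ (Σ*, s_*) ≅ ((Σ ⊗ W)*, (s ∘ w)_*)` of `LEM(Bim)`. -/
noncomputable def starComp {X Y Z : fREM.{u} k} (f : X ⟶ Y) (g : Y ⟶ Z) :
    starCell h f ≫ starCell h g ≅ starCell h (f ≫ g) :=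
  REM.isoStrict (Iso.op2_unop (isoOfBijective
      (tensorDual (C := Z.as.base) (B := Y.as.base) (A := X.as.base) g.obj.f f.obj.f)
      ((fREM.dualBasis g).tensorDual_bijective f.obj.f)))
    (congrArg Hom2.op2' ((fREM.isMate_starMap g).tensorDual (fREM.dualBasis (f ≫ g))
      (fREM.isMate_starMap f) (fREM.isMate_starMap (f ≫ g))))

/-- The isomorphism between the identity 1-cell `(A, C)` of `LEM(Bim)` and the dual of the identity
1-cell of `REM(Bim)`. -/
noncomputable def starId (X : fREM.{u} k) : 𝟙 X.as.op ≅ starCell h (𝟙 X) :=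
  REM.isoStrict (Iso.op2_unop (isoOfBijective (regularToDual X.as.base)
      (regularToDual_bijective X.as.base)))
    (congrArg Hom2.op2' ((fREM.isMate_starMap (𝟙 X)).regularToDual (fREM.dualBasis (𝟙 X))))

theorem isStrict_starComp {X Y Z : fREM.{u} k} (f : X ⟶ Y) (g : Y ⟶ Z) :
    REM.IsStrict (starComp h f g).hom (.op2'
      (tensorDual (C := Z.as.base) (B := Y.as.base) (A := X.as.base) g.obj.f f.obj.f)) := rfl

theorem isStrict_starId (X : fREM.{u} k) :
    REM.IsStrict (starId h X).hom (.op2' (regularToDual X.as.base)) := rfl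

theorem starComp_whiskerLeft {X Y Z : fREM.{u} k} (f : X ⟶ Y) {g g' : Y ⟶ Z} (a : g ⟶ g') :
    (starComp h f g').hom ≫ starCell₂ h (f ◁ a) =
      starCell h f ◁ starCell₂ h a ≫ (starComp h f g).hom := by
  refine REM.hom_ext ?_
  rw [(isStrict_starComp h f g').comp_hom, (isStrict_starComp h f g).hom_comp]
  exact congrArg Hom2.op2'
    ((fREM.isMate₂_starMap₂ a).tensorDual_left (fREM.isMate₂_starMap₂ (f ◁ a)))

theorem starComp_whiskerRight {X Y Z : fREM.{u} k} {f f' : X ⟶ Y} (a : f ⟶ f') (g : Y ⟶ Z) :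
    (starComp h f' g).hom ≫ starCell₂ h (a ▷ g) =
      starCell₂ h a ▷ starCell h g ≫ (starComp h f g).hom := by
  refine REM.hom_ext ?_
  rw [(isStrict_starComp h f' g).comp_hom, (isStrict_starComp h f g).hom_comp]
  exact congrArg Hom2.op2' ((fREM.isMate_starMap g).tensorDual_right
    (fREM.isMate₂_starMap₂ a) (fREM.isMate₂_starMap₂ (a ▷ g)))

theorem starComp_associator {X Y Z V : fREM.{u} k} (f : X ⟶ Y) (g : Y ⟶ Z) (l : Z ⟶ V) :
    starCell h f ◁ (starComp h g l).hom ≫ (starComp h f (g ≫ l)).hom ≫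
        starCell₂ h (α_ f g l).hom =
      (α_ _ _ _).inv ≫ (starComp h f g).hom ▷ starCell h l ≫ (starComp h (f ≫ g) l).hom := by
  have h1 := ((isStrict_starComp h g l).whiskerLeft (starCell h f)).comp
    ((isStrict_starComp h f (g ≫ l)).comp (isStrict_starCell₂ h (a := (α_ f g l).hom)
      (REM.isStrict_associator f.obj g.obj l.obj)))
  have h2 := (REM.isStrict_associator_inv (starCell h f) (starCell h g) (starCell h l)).comp
    (((isStrict_starComp h f g).whiskerRight (starCell h l)).comp
      (isStrict_starComp h (f ≫ g) l))
  refine h1.hom_eq h2 ?_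
  exact congrArg Hom2.op2' (tensorDual_assoc (A := X.as.base) (B := Y.as.base) (C := Z.as.base)
    (D := V.as.base) l.obj.f g.obj.f f.obj.f)

theorem starComp_leftUnitor {X Y : fREM.{u} k} (f : X ⟶ Y) :
    starCell₂ h (λ_ f).hom =
      (λ_ _).inv ≫ (starId h X).hom ▷ starCell h f ≫ (starComp h (𝟙 X) f).hom := by
  have h1 := isStrict_starCell₂ h (a := (λ_ f).hom) (REM.isStrict_leftUnitor f.obj)
  have h2 := (REM.isStrict_leftUnitor_inv (starCell h f)).comp
    (((isStrict_starId h X).whiskerRight (starCell h f)).comp (isStrict_starComp h (𝟙 X) f))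
  refine h1.hom_eq h2 ?_
  exact congrArg Hom2.op2' (dualMap_tensorRegular (B := Y.as.base) (A := X.as.base) f.obj.f)

theorem starComp_rightUnitor {X Y : fREM.{u} k} (f : X ⟶ Y) :
    starCell₂ h (ρ_ f).hom =
      (ρ_ _).inv ≫ starCell h f ◁ (starId h Y).hom ≫ (starComp h f (𝟙 Y)).hom := by
  have h1 := isStrict_starCell₂ h (a := (ρ_ f).hom) (REM.isStrict_rightUnitor f.obj)
  have h2 := (REM.isStrict_rightUnitor_inv (starCell h f)).comp
    (((isStrict_starId h Y).whiskerLeft (starCell h f)).comp (isStrict_starComp h f (𝟙 Y)))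
  refine h1.hom_eq h2 ?_
  exact congrArg Hom2.op2' (dualMap_regularTensor (B := Y.as.base) (A := X.as.base) f.obj.f)

theorem starCell₂_associator {X Y Z V : fREM.{u} k} (f : X ⟶ Y) (g : Y ⟶ Z) (l : Z ⟶ V) :
    starCell₂ h (α_ f g l).hom =
      ((((starComp h f (g ≫ l)).inv ≫ starCell h f ◁ (starComp h g l).inv) ≫
        (α_ (starCell h f) (starCell h g) (starCell h l)).inv) ≫
          (starComp h f g).hom ▷ starCell h l) ≫ (starComp h (f ≫ g) l).hom := by
  have := starComp_associator h f g l
  rw [Category.assoc, Category.assoc, ← this]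
  simp

theorem un₂_dualityFunctor_associator_hom {X Y Z V : fREM.{u} k} (f : X ⟶ Y) (g : Y ⟶ Z)
    (l : Z ⟶ V) :
    (Conj.un₂ (α_ ((dualityFunctor h X Y).obj f) ((dualityFunctor h Y Z).obj g)
      ((dualityFunctor h Z V).obj l)).hom).hom =
      (α_ (starCell h f) (starCell h g) (starCell h l)).inv :=
  Conj.un₂_associator_hom_hom _ _ _

/-- The duality functors on hom-categories as a pseudofunctor from `fREM(Bim)` to the conjugate of
`fLEM(Bim)`, the identity on objects. -/
noncomputable def dualityPseudofunctor : fREM.{u} k ⥤ᵖ Conj (fLEM.{u} k) where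
  toPrelaxFunctor :=
    PrelaxFunctor.mkOfHomFunctors (fun X => ⟨⟨X.as⟩⟩) (fun X Y => dualityFunctor h X Y)
  mapId X := Conj.iso₂ (ObjectProperty.isoMk _ (starId h X).symm)
  mapComp f g := Conj.iso₂ (ObjectProperty.isoMk _ (starComp h f g).symm)
  map₂_whisker_left f g g' a := by
    rw [← Category.assoc, Iso.eq_comp_inv]
    exact Conj.hom_ext (ObjectProperty.hom_ext _ (starComp_whiskerLeft h f a))
  map₂_whisker_right a g := by
    rw [← Category.assoc, Iso.eq_comp_inv]
    exact Conj.hom_ext (ObjectProperty.hom_ext _ (starComp_whiskerRight h a g))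
  map₂_associator f g l := by
    refine Conj.hom_ext (ObjectProperty.hom_ext _ ((starCell₂_associator h f g l).trans ?_))
    -- the two associators are matched by a rewriting step, since unfolding them is expensive
    exact congrArg (fun x => ((((starComp h f (g ≫ l)).inv ≫
      starCell h f ◁ (starComp h g l).inv) ≫ x) ≫ (starComp h f g).hom ▷ starCell h l) ≫
        (starComp h (f ≫ g) l).hom) (un₂_dualityFunctor_associator_hom h f g l).symm
  map₂_left_unitor f :=
    Conj.hom_ext (ObjectProperty.hom_ext _ ((starComp_leftUnitor h f).trans
      (Category.assoc _ _ _).symm))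
  map₂_right_unitor f :=
    Conj.hom_ext (ObjectProperty.hom_ext _ ((starComp_rightUnitor h f).trans
      (Category.assoc _ _ _).symm))

end

theorem proposition2p4 (k : Type v) [CommRing k] :
    ∃ h : DualityLaws.{u} k,
      (∀ X Y : fREM.{u} k, (dualityFunctor h X Y).IsEquivalence) ∧
      ∃ F : fREM.{u} k ⥤ᵖ Conj (fLEM.{u} k),
        F.toPrelaxFunctor =
          PrelaxFunctor.mkOfHomFunctors (fun X => ⟨⟨X.as⟩⟩) (fun X Y => dualityFunctor h X Y) ∧
        IsBiequivalence F := by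
  refine ⟨dualityLaws k, fun X Y => inferInstance, dualityPseudofunctor (dualityLaws k), rfl, ?_⟩
  exact ⟨fun X Y => dualityFunctor_isEquivalence (dualityLaws k) X Y,
    fun c => ⟨⟨c.as.as⟩, ⟨Bicategory.Equivalence.id c⟩⟩⟩
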